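/- Let $\alpha,\beta\in\mathbb R$ be non-zero, let $I\subseteq\mathbb R$ be a non-empty open interval, and let $h(x,t)$ be a smooth ($C^\infty$) real function of $x\in\mathbb R$, $t\in I$. Consider the forced Ostrovsky potential equation $$v_{tx}+v_xv_{xx}+\alpha v_{xxxx}-\beta v-h(x,t)=0 \qquad (\ast)$$ for $v(t,x)$. A point symmetry of $(\ast)$ is a smooth vector field ${\rm X}=\tau(t,x,v)\partial_t+\xi(t,x,v)\partial_x+\eta(t,x,v)\partial_v$ on $I\times\mathbb R\times\mathbb R$ such that ${\rm pr}^{(4)}{\rm X}\,(v_{tx}+v_xv_{xx}+\alpha v_{xxxx}-\beta v-h)=0$ at every jet satisfying $(\ast)$, where ${\rm pr}^{(4)}$ is the fourth prolongation. Primes denote derivatives, $\int f\,dt$ denotes an antiderivative of $f$ on $I$ (the same one wherever it occurs in a formula), and all coefficient functions below are smooth. (i) The point symmetries of $(\ast)$ are generated by: * if $h(x,t)=h_1(\chi)-\beta c(t)\chi+h_0(t)$ with $\chi=x-\int c(t)\,dt$ for some functions $c,h_0$ on $I$ and $h_1$ on $\mathbb R$: $${\rm X}_1=\partial_t+c(t)\partial_x+\Big(c'(t)\big(x-\textstyle\int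 c(t)\,dt\big)+\tfrac1\beta c''(t)-\tfrac1\beta h_0'(t)\Big)\partial_v;$$ * if $h(x,t)=h_2(t)x^2+h_1(t)x+h_0(t)$ for some functions $h_2,h_1,h_0$ on $I$: $${\rm X}_2=e^{-\frac2\beta\int h_2\,dt}\Big(\partial_x+\big(\tfrac4{\beta^3}h_2(t)^2-\tfrac2{\beta^2}h_2'(t)-\tfrac1\beta h_1(t)-\tfrac2\beta h_2(t)x\big)\partial_v\Big).$$ That is: whenever $h$ has the first (second) form, ${\rm X}_1$ (respectively ${\rm X}_2$) is a point symmetry; and the set of all point symmetries is $\{0\}$ if $h$ has neither form, $\mathrm{span}\{{\rm X}_1\}$ if it has only the first, $\mathrm{span}\{{\rm X}_2\}$ if it has only the second, and $\mathrm{span}\{{\rm X}_1,{\rm X}_2\}$ if it has both (for any representation of $h$ in the respective forms). (ii) $h$ has both forms if and only if $$h(x,t)=\tilde h_2x^2+\tilde h_1(t)x+\tilde h_0(t)$$ with a constant $\tilde h_2$ and functions $\tilde h_1,\tilde h_0$ on $I$. In this case the point symmetries form a two-dimensional solvable Lie algebra, and, with the usual commutator $[{\rm X},{\rm Y}]={\rm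 X}{\rm Y}-{\rm Y}{\rm X}$, $$[{\rm X}_1,{\rm X}_2]=-\tfrac{2\tilde h_2}{\beta}{\rm X}_2 .$$ The coefficients of $h$ in the second form are then $h_2(t)=\tilde h_2$, $h_1(t)=\tilde h_1(t)$, $h_0(t)=\tilde h_0(t)$. Moreover $h$ can be written in the first form with $h_1(\chi)=\tilde h_2\chi^2$, and with this $h_1$ the functions $c$, $\int c\,dt$ and $h_0$ represent $h$ in the first form if and only if, for some antiderivative $\int e^{\frac{2\tilde h_2}{\beta}t}\tilde h_1(t)\,dt$, $$\textstyle\int c(t)\,dt=-\tfrac1\beta e^{-\frac{2\tilde h_2}{\beta}t}\int e^{\frac{2\tilde h_2}{\beta}t}\tilde h_1(t)\,dt,\qquad c(t)=-\Big(\tfrac1\beta e^{-\frac{2\tilde h_2}{\beta}t}\int e^{\frac{2\tilde h_2}{\beta}t}\tilde h_1(t)\,dt\Big)',$$ $$\textstyle h_0(t)=\tilde h_0(t)-\tilde h_2\big(\int c(t)\,dt\big)^2-\beta c(t)\int c(t)\,dt .$$ -/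

import Mathlib

open scoped ContDiff

noncomputable section

namespace Ostrovsky

/-- The space of the independent and dependent variables, with coordinates `(t, x, v)`. -/
abbrev Base := ℝ × ℝ × ℝ

/-- The open set of points `(t, x, v)` with `t ∈ I`. -/
def strip (I : TopologicalSpace.Opens ℝ) : Set Base := {p | p.1 ∈ I}

theorem isOpen_strip (I : TopologicalSpace.Opens ℝ) : IsOpen (strip I) :=
  I.isOpen.preimage continuous_fst

/-- Smooth vector fields `τ ∂_t + ξ ∂_x + η ∂_v` on the strip over `I`. A field is its triple of
components `(τ, ξ, η)`; since only its values on the strip matter, it is normalised to be zero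
off the strip. -/
def SmoothField (I : TopologicalSpace.Opens ℝ) : Submodule ℝ (Base → Base) where
  carrier := {V | ContDiffOn ℝ ∞ V (strip I) ∧ ∀ p ∉ strip I, V p = 0}
  add_mem' := fun hV hW => ⟨hV.1.add hW.1, fun p hp => by simp [hV.2 p hp, hW.2 p hp]⟩
  zero_mem' := ⟨contDiffOn_const, fun _ _ => rfl⟩
  smul_mem' := fun r _ hV => ⟨hV.1.const_smul r, fun p hp => by simp [hV.2 p hp]⟩

variable {I : TopologicalSpace.Opens ℝ}

/-- The vector field on the strip given by smooth components. -/
def SmoothField.of (I : TopologicalSpace.Opens ℝ) (V : Base → Base)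
    (hV : ContDiffOn ℝ ∞ V (strip I)) : SmoothField I :=
  ⟨(strip I).indicator V, hV.congr fun _ hp => Set.indicator_of_mem hp V,
    fun _ hp => Set.indicator_of_notMem hp V⟩

theorem contDiffAt_field (V : SmoothField I) {p : Base} (hp : p ∈ strip I) :
    ContDiffAt ℝ ∞ V.1 p :=
  V.2.1.contDiffAt ((isOpen_strip I).mem_nhds hp)

theorem differentiableAt_field (V : SmoothField I) {p : Base} (hp : p ∈ strip I) :
    DifferentiableAt ℝ V.1 p :=
  (contDiffAt_field V hp).differentiableAt (by simp)

theorem contDiffOn_lieBracket (V W : SmoothField I) :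
    ContDiffOn ℝ ∞ (VectorField.lieBracket ℝ V.1 W.1) (strip I) := fun _ hp =>
  (ContDiffAt.lieBracket_vectorField (n := ∞) (contDiffAt_field V hp) (contDiffAt_field W hp)
    (by simp)).contDiffWithinAt

/-- The commutator `[V, W] = V W - W V` of vector fields on the strip. -/
instance : Bracket (SmoothField I) (SmoothField I) where
  bracket V W := SmoothField.of I (VectorField.lieBracket ℝ V.1 W.1) (contDiffOn_lieBracket V W)

theorem SmoothField.ext_strip {V W : SmoothField I} (hVW : ∀ p ∈ strip I, V.1 p = W.1 p) :
    V = W := by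
  apply Subtype.ext
  funext p
  by_cases hp : p ∈ strip I
  · exact hVW p hp
  · rw [V.2.2 p hp, W.2.2 p hp]

theorem SmoothField.lie_apply (V W : SmoothField I) {p : Base} (hp : p ∈ strip I) :
    (⁅V, W⁆ : SmoothField I).1 p = VectorField.lieBracket ℝ V.1 W.1 p :=
  Set.indicator_of_mem hp _

theorem SmoothField.lie_eventuallyEq (V W : SmoothField I) {p : Base} (hp : p ∈ strip I) :
    (⁅V, W⁆ : SmoothField I).1 =ᶠ[nhds p] VectorField.lieBracket ℝ V.1 W.1 := by
  filter_upwards [(isOpen_strip I).mem_nhds hp] with q hq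
  exact SmoothField.lie_apply V W hq

instance : LieRing (SmoothField I) where
  add_lie U V W := SmoothField.ext_strip fun p hp => by
    have := VectorField.lieBracket_add_left (W := W.1)
      (differentiableAt_field U hp) (differentiableAt_field V hp)
    simpa [SmoothField.lie_apply _ _ hp] using this
  lie_add U V W := SmoothField.ext_strip fun p hp => by
    have := VectorField.lieBracket_add_right (V := U.1)
      (differentiableAt_field V hp) (differentiableAt_field W hp)
    simpa [SmoothField.lie_apply _ _ hp] using this
  lie_self V := SmoothField.ext_strip fun p hp => by
    simp [SmoothField.lie_apply _ _ hp]
  leibniz_lie U V W := SmoothField.ext_strip fun p hp => by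
    have key := VectorField.leibniz_identity_lieBracket (𝕜 := ℝ) (n := ∞)
      (by simpa using (WithTop.coe_le_coe.2 le_top : ((2 : ℕ∞) : WithTop ℕ∞) ≤ ((⊤ : ℕ∞) : WithTop ℕ∞)))
      (contDiffAt_field U hp) (contDiffAt_field V hp) (contDiffAt_field W hp)
    have e1 := (Filter.EventuallyEq.refl (nhds p) U.1).lieBracket_vectorField_eq (𝕜 := ℝ)
      (SmoothField.lie_eventuallyEq V W hp)
    have e2 := (SmoothField.lie_eventuallyEq U V hp).lieBracket_vectorField_eq (𝕜 := ℝ)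
      (Filter.EventuallyEq.refl (nhds p) W.1)
    have e3 := (Filter.EventuallyEq.refl (nhds p) V.1).lieBracket_vectorField_eq (𝕜 := ℝ)
      (SmoothField.lie_eventuallyEq U W hp)
    have s : ∀ A B : SmoothField I, (A + B).1 p = A.1 p + B.1 p := fun _ _ => rfl
    rw [s, SmoothField.lie_apply _ _ hp, SmoothField.lie_apply _ _ hp,
      SmoothField.lie_apply _ _ hp, e1, e2, e3, key]

instance : LieAlgebra ℝ (SmoothField I) where
  lie_smul r V W := SmoothField.ext_strip fun p hp => by
    have := VectorField.lieBracket_const_smul_right (c := r) (V := V.1) (differentiableAt_field W hp)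
    simpa [SmoothField.lie_apply _ _ hp] using this

/-- Jets of functions `v(t, x)`: a jet is `(t, x, u)`, where `u a b` is the value of the jet
variable `∂_t ^ a ∂_x ^ b v`. Differential functions are functions on jets that depend on
finitely many jet variables. -/
abbrev Jet := ℝ × ℝ × (ℕ → ℕ → ℝ)

/-- The point `(t, x, v)` under a jet. -/
def Jet.base (j : Jet) : Base := (j.1, j.2.1, j.2.2 0 0)

/-- The total derivative `D_t = ∂_t + v_t ∂_v + v_tt ∂_{v_t} + v_tx ∂_{v_x} + ⋯`. -/
def totalDt (F : Jet → ℝ) (j : Jet) : ℝ :=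
  lineDeriv ℝ F j (1, 0, fun a b => j.2.2 (a + 1) b)

/-- The total derivative `D_x = ∂_x + v_x ∂_v + v_tx ∂_{v_t} + v_xx ∂_{v_x} + ⋯`. -/
def totalDx (F : Jet → ℝ) (j : Jet) : ℝ :=
  lineDeriv ℝ F j (0, 1, fun a b => j.2.2 a (b + 1))

/-- The characteristic `η - τ v_t - ξ v_x` of the vector field `τ ∂_t + ξ ∂_x + η ∂_v`. -/
def characteristic (V : Base → Base) (j : Jet) : ℝ :=
  (V j.base).2.2 - (V j.base).1 * j.2.2 1 0 - (V j.base).2.1 * j.2.2 0 1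

/-- The coefficient of `∂/∂(∂_t ^ a ∂_x ^ b v)` in the prolongation of `τ ∂_t + ξ ∂_x + η ∂_v`:
`D_t ^ a D_x ^ b (η - τ v_t - ξ v_x) + τ ∂_t ^ (a+1) ∂_x ^ b v + ξ ∂_t ^ a ∂_x ^ (b+1) v`. -/
def prolongCoeff (V : Base → Base) (a b : ℕ) (j : Jet) : ℝ :=
  (totalDt^[a] (totalDx^[b] (characteristic V))) j
    + (V j.base).1 * j.2.2 (a + 1) b + (V j.base).2.1 * j.2.2 a (b + 1)

/-- The `n`-th prolongation of the vector field `V`, as a derivation of differential functions. -/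
def prolong (n : ℕ) (V : Base → Base) (F : Jet → ℝ) (j : Jet) : ℝ :=
  lineDeriv ℝ F j
    ((V j.base).1, (V j.base).2.1, fun a b => if a + b ≤ n then prolongCoeff V a b j else 0)

/-- The differential function `v_tx + v_x v_xx + α v_xxxx - β v - h(x, t)`. -/
def potentialEq (α β : ℝ) (h : ℝ → ℝ → ℝ) (j : Jet) : ℝ :=
  j.2.2 1 1 + j.2.2 0 1 * j.2.2 0 2 + α * j.2.2 0 4 - β * j.2.2 0 0 - h j.2.1 j.1

/-- The infinitesimal generators of the Lie point symmetries of the potential equation, for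
`t ∈ I`: the fourth prolongation annihilates the equation at all jets that satisfy it. -/
def pointSymmetries (I : TopologicalSpace.Opens ℝ) (α β : ℝ) (h : ℝ → ℝ → ℝ) :
    Set (SmoothField I) :=
  {X | ∀ j : Jet, j.1 ∈ I → potentialEq α β h j = 0 →
    prolong 4 X.1 (potentialEq α β h) j = 0}

/-- Functions `c(t)`, `∫ c(t) dt` (some antiderivative), `h₀(t)` and `h₁(χ)`, with `t ∈ I`. -/
structure BoostData (I : TopologicalSpace.Opens ℝ) where
  c : ℝ → ℝ
  intc : ℝ → ℝ
  h₀ : ℝ → ℝ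
  h₁ : ℝ → ℝ
  contDiffOn_c : ContDiffOn ℝ ∞ c I
  hasDerivAt_intc : ∀ t ∈ I, HasDerivAt intc (c t) t
  contDiffOn_h₀ : ContDiffOn ℝ ∞ h₀ I
  contDiff_h₁ : ContDiff ℝ ∞ h₁

/-- `h(x, t) = h₁(χ) - β c(t) χ + h₀(t)` with `χ = x - ∫ c(t) dt`. -/
def BoostData.IsForcing (d : BoostData I) (β : ℝ) (h : ℝ → ℝ → ℝ) : Prop :=
  ∀ x : ℝ, ∀ t ∈ I,
    h x t = d.h₁ (x - d.intc t) - β * d.c t * (x - d.intc t) + d.h₀ t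

/-- Functions `h₂(t)`, `∫ h₂(t) dt` (some antiderivative), `h₁(t)` and `h₀(t)`, with `t ∈ I`. -/
structure FrameData (I : TopologicalSpace.Opens ℝ) where
  h₂ : ℝ → ℝ
  inth₂ : ℝ → ℝ
  h₁ : ℝ → ℝ
  h₀ : ℝ → ℝ
  contDiffOn_h₂ : ContDiffOn ℝ ∞ h₂ I
  hasDerivAt_inth₂ : ∀ t ∈ I, HasDerivAt inth₂ (h₂ t) t
  contDiffOn_h₁ : ContDiffOn ℝ ∞ h₁ I
  contDiffOn_h₀ : ContDiffOn ℝ ∞ h₀ I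

/-- `h(x, t) = h₂(t) x² + h₁(t) x + h₀(t)`. -/
def FrameData.IsForcing (d : FrameData I) (h : ℝ → ℝ → ℝ) : Prop :=
  ∀ x : ℝ, ∀ t ∈ I, h x t = d.h₂ t * x ^ 2 + d.h₁ t * x + d.h₀ t

theorem contDiffOn_comp_fst {f : ℝ → ℝ} (hf : ContDiffOn ℝ ∞ f I) :
    ContDiffOn ℝ ∞ (fun p : Base => f p.1) (strip I) :=
  hf.comp contDiffOn_fst fun _ hp => hp

theorem contDiffOn_deriv {f : ℝ → ℝ} (hf : ContDiffOn ℝ ∞ f I) :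
    ContDiffOn ℝ ∞ (deriv f) I :=
  hf.deriv_of_isOpen I.isOpen (by simp)

theorem contDiffOn_antideriv {f F : ℝ → ℝ} (hf : ContDiffOn ℝ ∞ f I)
    (hF : ∀ t ∈ I, HasDerivAt F (f t) t) : ContDiffOn ℝ ∞ F I := by
  rw [contDiffOn_infty_iff_deriv_of_isOpen I.isOpen]
  exact ⟨fun t ht => (hF t ht).differentiableAt.differentiableWithinAt,
    hf.congr fun t ht => (hF t ht).deriv⟩

theorem contDiffOn_coord_x : ContDiffOn ℝ ∞ (fun p : Base => p.2.1) (strip I) :=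
  (contDiff_fst.comp contDiff_snd).contDiffOn

/-- The generator
`∂_t + c(t) ∂_x + (c'(t) (x - ∫ c(t) dt) + (1/β) c''(t) - (1/β) h₀'(t)) ∂_v`. -/
def BoostData.generator (d : BoostData I) (β : ℝ) : SmoothField I :=
  SmoothField.of I
    (fun p => (1, d.c p.1,
      deriv d.c p.1 * (p.2.1 - d.intc p.1) + 1 / β * deriv (deriv d.c) p.1
        - 1 / β * deriv d.h₀ p.1)) <| by
    have hc := d.contDiffOn_c
    have hC := contDiffOn_antideriv hc d.hasDerivAt_intc
    exact contDiffOn_const.prodMk ((contDiffOn_comp_fst hc).prodMk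
      ((((contDiffOn_comp_fst (contDiffOn_deriv hc)).mul
          (contDiffOn_coord_x.sub (contDiffOn_comp_fst hC))).add
        (contDiffOn_const.mul (contDiffOn_comp_fst (contDiffOn_deriv (contDiffOn_deriv hc))))).sub
        (contDiffOn_const.mul (contDiffOn_comp_fst (contDiffOn_deriv d.contDiffOn_h₀)))))

/-- The generator
`E(t) ∂_x + E(t) ((4/β³) h₂(t)² - (2/β²) h₂'(t) - (1/β) h₁(t) - (2/β) h₂(t) x) ∂_v`
with `E(t) = exp (-(2/β) ∫ h₂(t) dt)`. -/
def FrameData.generator (d : FrameData I) (β : ℝ) : SmoothField I :=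
  SmoothField.of I
    (fun p => (0, Real.exp (-(2 / β) * d.inth₂ p.1),
      Real.exp (-(2 / β) * d.inth₂ p.1) *
        (4 / β ^ 3 * d.h₂ p.1 ^ 2 - 2 / β ^ 2 * deriv d.h₂ p.1 - 1 / β * d.h₁ p.1
          - 2 / β * d.h₂ p.1 * p.2.1))) <| by
    have h2 := d.contDiffOn_h₂
    have hE : ContDiffOn ℝ ∞ (fun p : Base => Real.exp (-(2 / β) * d.inth₂ p.1)) (strip I) :=
      (contDiffOn_const.mul
        (contDiffOn_comp_fst (contDiffOn_antideriv h2 d.hasDerivAt_inth₂))).exp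
    exact contDiffOn_const.prodMk (hE.prodMk (hE.mul
      ((((contDiffOn_const.mul ((contDiffOn_comp_fst h2).pow 2)).sub
        (contDiffOn_const.mul (contDiffOn_comp_fst (contDiffOn_deriv h2)))).sub
        (contDiffOn_const.mul (contDiffOn_comp_fst d.contDiffOn_h₁))).sub
        ((contDiffOn_const.mul (contDiffOn_comp_fst h2)).mul contDiffOn_coord_x))))

end Ostrovsky

end

/-!
The point symmetries are found from the determining equations. Total derivatives obey the Leibniz
rule, so the prolongation coefficients of `τ ∂_t + ξ ∂_x + η ∂_v` expand into total derivatives of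
`τ`, `ξ`, `η` times jet variables. On the solution set `v_tx` is eliminated, and the remaining jet
variables are free:

* `v_txxx` occurs only in `-4 α D_x τ v_txxx`, so `τ = τ(t)` (`px_tau_eq_zero`);
* `v_t` then occurs linearly, and its coefficient gives `ξ_v = 0`, `η_vv = η_vx = 0`
  (`affine_in_v`);
* the terms with `v_xxx`, `v_xxxx`, `v_x v_xx`, `v_xx`, `v_x` and `v` give `τ' = ξ_x = η_v = 0` and
  `η_x = ξ_t` (`determining_of_mem`).

Hence the symmetries are exactly the fields `T ∂_t + c(t) ∂_x + (c'(t) x + g(t)) ∂_v` with constant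
`T` and `c'' - β (c' x + g) - c h_x - T h_t = 0` (`mem_pointSymmetries_iff`).

If `T ≠ 0`, without loss of generality `T = 1`, this equation prescribes the derivative of `h` along
`x = χ + ∫ c dt`, up to terms in `t` alone, as that of `-β c χ`; so `h` has the first form (`HasForm.exists_boostData`). If `T = 0`,
its `x`-dependence shows that `c` solves a first-order linear homogeneous equation. So either `c`
has no zero, whence `h_x` is affine in `x` and `h` has the second form
(`HasForm.exists_frameData`), or the symmetry vanishes (`HasForm.eq_zero`). Subtraction of
multiples of the generators reduces all cases of the classification to these two.

If `h` has both forms, the second difference of `h` along `x = χ + ∫ c dt` is `2 h₂(t)` by one form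
and independent of `t` by the other, so `h₂` is constant. The first form with `h₁ = k χ²` amounts
to the linear equation `(∫ c dt)' = -(2 k / β) ∫ c dt - l₁ / β`, which is solved by an integrating
factor (`BoostData.isForcing_iff`).
-/

noncomputable section

namespace Ostrovsky

variable {I : TopologicalSpace.Opens ℝ}

/-! ### Smooth differential functions and their total derivatives -/

/-- A map `γ` into the jets is a smooth plot at `y` if all the jet coordinates are smooth along it
and it passes over a point of `I`. -/
structure IsPlotAt (I : TopologicalSpace.Opens ℝ) {E : Type} [NormedAddCommGroup E]
    [NormedSpace ℝ E] (γ : E → Jet) (y : E) : Prop where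
  mem : (γ y).1 ∈ I
  time : ContDiffAt ℝ ∞ (fun z => (γ z).1) y
  space : ContDiffAt ℝ ∞ (fun z => (γ z).2.1) y
  coord : ∀ a b, ContDiffAt ℝ ∞ (fun z => (γ z).2.2 a b) y

/-- Smoothness over `I` of a function on the (infinite-dimensional) jets, in the diffeological
sense: it is smooth along all smooth finite- or infinite-dimensional plots. This makes the
stability under total derivatives independent of the number of jet variables involved. -/
def IsSmooth (I : TopologicalSpace.Opens ℝ) (F : Jet → ℝ) : Prop :=
  ∀ (E : Type) [NormedAddCommGroup E] [NormedSpace ℝ E] (γ : E → Jet) (y : E),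
    IsPlotAt I γ y → ContDiffAt ℝ ∞ (fun z => F (γ z)) y

/-- The jet variable `∂_t ^ a ∂_x ^ b v`. -/
def jetVar (a b : ℕ) (j : Jet) : ℝ := j.2.2 a b

theorem isSmooth_const (r : ℝ) : IsSmooth I fun _ => r := fun _ _ _ _ _ _ => contDiffAt_const

theorem isSmooth_jetVar (a b : ℕ) : IsSmooth I (jetVar a b) := fun _ _ _ _ _ hγ => hγ.coord a b

theorem IsSmooth.add {F G : Jet → ℝ} (hF : IsSmooth I F) (hG : IsSmooth I G) :
    IsSmooth I (F + G) := fun E _ _ γ y hγ => (hF E γ y hγ).add (hG E γ y hγ)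

theorem IsSmooth.sub {F G : Jet → ℝ} (hF : IsSmooth I F) (hG : IsSmooth I G) :
    IsSmooth I (F - G) := fun E _ _ γ y hγ => (hF E γ y hγ).sub (hG E γ y hγ)

theorem IsSmooth.mul {F G : Jet → ℝ} (hF : IsSmooth I F) (hG : IsSmooth I G) :
    IsSmooth I (F * G) := fun E _ _ γ y hγ => (hF E γ y hγ).mul (hG E γ y hγ)

theorem isSmooth_comp_base {f : Base → ℝ} (hf : ContDiffOn ℝ ∞ f (strip I)) :
    IsSmooth I fun j => f j.base := fun _ _ _ γ y hγ =>
  (hf.contDiffAt ((isOpen_strip I).mem_nhds (x := (γ y).base) hγ.mem)).comp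
    (f := fun z => (γ z).base) y (hγ.time.prodMk (hγ.space.prodMk (hγ.coord 0 0)))

theorem IsSmooth.lineDeriv {F : Jet → ℝ} (hF : IsSmooth I F) {w : Jet → Jet}
    (ht : IsSmooth I fun j => (w j).1) (hx : IsSmooth I fun j => (w j).2.1)
    (hu : ∀ a b, IsSmooth I fun j => (w j).2.2 a b) :
    IsSmooth I fun j => _root_.lineDeriv ℝ F j (w j) := by
  intro E _ _ γ y hγ
  -- The lines in the direction `w` through a plot form a plot with one more parameter.
  have key : IsPlotAt I (fun z : E × ℝ => γ z.1 + z.2 • w (γ z.1)) (y, 0) := by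
    have lift : ∀ {g k : E → ℝ}, ContDiffAt ℝ ∞ g y → ContDiffAt ℝ ∞ k y →
        ContDiffAt ℝ ∞ (fun z : E × ℝ => g z.1 + z.2 * k z.1) (y, 0) := fun hg hk =>
      (hg.comp (y, (0 : ℝ)) contDiffAt_fst).add
        (contDiffAt_snd.mul (hk.comp (y, (0 : ℝ)) contDiffAt_fst))
    exact ⟨by simpa using hγ.mem, lift hγ.time (ht E γ y hγ), lift hγ.space (hx E γ y hγ),
      fun a b => lift (hγ.coord a b) (hu a b E γ y hγ)⟩
  have h1 := ContDiffAt.fderiv (f := fun z s => F (γ z + s • w (γ z))) (g := fun _ => (0 : ℝ))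
    (m := ∞) (hF (E × ℝ) _ (y, 0) key) contDiffAt_const (by simp)
  exact h1.clm_apply (contDiffAt_const (c := (1 : ℝ)))

theorem IsSmooth.totalDx {F : Jet → ℝ} (hF : IsSmooth I F) : IsSmooth I (totalDx F) :=
  hF.lineDeriv (w := fun j => (0, 1, fun a b => j.2.2 a (b + 1))) (isSmooth_const 0)
    (isSmooth_const 1) fun a b => isSmooth_jetVar a (b + 1)

theorem IsSmooth.iterate_totalDx {F : Jet → ℝ} (hF : IsSmooth I F) :
    ∀ n : ℕ, IsSmooth I (Ostrovsky.totalDx^[n] F)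
  | 0 => hF
  | n + 1 => IsSmooth.iterate_totalDx hF.totalDx n

theorem IsSmooth.lineDifferentiableAt {F : Jet → ℝ} (hF : IsSmooth I F) {j : Jet} (hj : j.1 ∈ I)
    (w : Jet) : LineDifferentiableAt ℝ F j w := by
  have lift : ∀ a b : ℝ, ContDiffAt ℝ ∞ (fun s : ℝ => a + s * b) 0 := fun a b =>
    contDiffAt_const.add (contDiffAt_id.mul contDiffAt_const)
  exact (hF ℝ (fun s => j + s • w) 0 ⟨by simpa using hj, lift _ _, lift _ _,
    fun a b => lift _ _⟩).differentiableAt (by simp)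

theorem lineDeriv_jet_add {F G : Jet → ℝ} (hF : IsSmooth I F) (hG : IsSmooth I G) {j : Jet}
    (hj : j.1 ∈ I) (w : Jet) : lineDeriv ℝ (F + G) j w = lineDeriv ℝ F j w + lineDeriv ℝ G j w :=
  deriv_add (hF.lineDifferentiableAt hj w) (hG.lineDifferentiableAt hj w)

theorem lineDeriv_jet_sub {F G : Jet → ℝ} (hF : IsSmooth I F) (hG : IsSmooth I G) {j : Jet}
    (hj : j.1 ∈ I) (w : Jet) : lineDeriv ℝ (F - G) j w = lineDeriv ℝ F j w - lineDeriv ℝ G j w :=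
  deriv_sub (hF.lineDifferentiableAt hj w) (hG.lineDifferentiableAt hj w)

theorem lineDeriv_jet_mul {F G : Jet → ℝ} (hF : IsSmooth I F) (hG : IsSmooth I G) {j : Jet}
    (hj : j.1 ∈ I) (w : Jet) :
    lineDeriv ℝ (F * G) j w = lineDeriv ℝ F j w * G j + F j * lineDeriv ℝ G j w := by
  refine (deriv_mul (hF.lineDifferentiableAt hj w) (hG.lineDifferentiableAt hj w)).trans ?_
  simp [lineDeriv]

theorem lineDeriv_jetVar (a b : ℕ) (j w : Jet) : lineDeriv ℝ (jetVar a b) j w = w.2.2 a b := by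
  have : HasDerivAt (fun s : ℝ => j.2.2 a b + s * w.2.2 a b) (w.2.2 a b) 0 := by
    simpa using ((hasDerivAt_id (0 : ℝ)).mul_const (w.2.2 a b)).const_add (j.2.2 a b)
  exact this.deriv

/-- Functions that agree over `I` have the same directional derivatives over `I`. -/
theorem lineDeriv_jet_congr {F G : Jet → ℝ} (hFG : ∀ j : Jet, j.1 ∈ I → F j = G j) {j : Jet}
    (hj : j.1 ∈ I) (w : Jet) : lineDeriv ℝ F j w = lineDeriv ℝ G j w := by
  apply Filter.EventuallyEq.deriv_eq
  have hc : ContinuousAt (fun s : ℝ => j.1 + s * w.1) 0 := by fun_prop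
  have hm : (I : Set ℝ) ∈ nhds (j.1 + 0 * w.1) := I.isOpen.mem_nhds (by simpa using hj)
  filter_upwards [hc hm] with s hs
  exact hFG _ hs

theorem iterate_totalDx_congr {F G : Jet → ℝ} (hFG : ∀ j : Jet, j.1 ∈ I → F j = G j) (n : ℕ) :
    ∀ j : Jet, j.1 ∈ I → totalDx^[n] F j = totalDx^[n] G j := by
  induction n generalizing F G with
  | zero => exact hFG
  | succ n ih => exact ih fun j hj => lineDeriv_jet_congr hFG hj _

theorem iterate_totalDx_add {F G : Jet → ℝ} (hF : IsSmooth I F) (hG : IsSmooth I G) (n : ℕ)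
    {j : Jet} (hj : j.1 ∈ I) :
    totalDx^[n] (F + G) j = totalDx^[n] F j + totalDx^[n] G j := by
  induction n generalizing F G with
  | zero => rfl
  | succ n ih =>
    rw [Function.iterate_succ_apply, Function.iterate_succ_apply, Function.iterate_succ_apply,
      ← ih hF.totalDx hG.totalDx]
    exact iterate_totalDx_congr (fun j hj => lineDeriv_jet_add hF hG hj _) n j hj

theorem iterate_totalDx_sub {F G : Jet → ℝ} (hF : IsSmooth I F) (hG : IsSmooth I G) (n : ℕ)
    {j : Jet} (hj : j.1 ∈ I) :
    totalDx^[n] (F - G) j = totalDx^[n] F j - totalDx^[n] G j := by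
  have := iterate_totalDx_add (hF.sub hG) hG n hj
  rw [sub_add_cancel] at this
  linarith

/-- One step of the Leibniz rule for `D_x ^ n` of a multiple of a jet variable. -/
theorem iterate_totalDx_succ_mul_jetVar {F : Jet → ℝ} (hF : IsSmooth I F) (n a b : ℕ) {j : Jet}
    (hj : j.1 ∈ I) :
    totalDx^[n + 1] (F * jetVar a b) j
      = totalDx^[n] (totalDx F * jetVar a b) j + totalDx^[n] (F * jetVar a (b + 1)) j := by
  rw [Function.iterate_succ_apply, ← iterate_totalDx_add (hF.totalDx.mul (isSmooth_jetVar a b))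
    (hF.mul (isSmooth_jetVar a (b + 1))) n hj]
  refine iterate_totalDx_congr (fun j hj => ?_) n j hj
  exact (lineDeriv_jet_mul hF (isSmooth_jetVar a b) hj _).trans
    (by rw [lineDeriv_jetVar]; rfl)

/-! ### Partial derivatives on the base -/

/-- The partial derivative of a function on the base in the direction `w`. -/
def partialD (w : Base) (f : Base → ℝ) (p : Base) : ℝ := lineDeriv ℝ f p w

/-- `∂/∂t` on functions of `(t, x, v)`. -/
abbrev pt : (Base → ℝ) → Base → ℝ := partialD (1, 0, 0)

/-- `∂/∂x` on functions of `(t, x, v)`. -/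
abbrev px : (Base → ℝ) → Base → ℝ := partialD (0, 1, 0)

/-- `∂/∂v` on functions of `(t, x, v)`. -/
abbrev pv : (Base → ℝ) → Base → ℝ := partialD (0, 0, 1)

theorem differentiableAt_of_strip {f : Base → ℝ} (hf : ContDiffOn ℝ ∞ f (strip I)) {p : Base}
    (hp : p ∈ strip I) : DifferentiableAt ℝ f p :=
  (hf.contDiffAt ((isOpen_strip I).mem_nhds hp)).differentiableAt (by simp)

theorem partialD_eq_fderiv {f : Base → ℝ} (hf : ContDiffOn ℝ ∞ f (strip I)) {p : Base}
    (hp : p ∈ strip I) (w : Base) : partialD w f p = fderiv ℝ f p w :=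
  (differentiableAt_of_strip hf hp).lineDeriv_eq_fderiv

theorem contDiffOn_partialD {f : Base → ℝ} (hf : ContDiffOn ℝ ∞ f (strip I)) (w : Base) :
    ContDiffOn ℝ ∞ (partialD w f) (strip I) :=
  ((hf.fderiv_of_isOpen (isOpen_strip I) (m := ∞) (by simp)).clm_apply contDiffOn_const).congr
    fun _ hp => partialD_eq_fderiv hf hp w

theorem contDiffOn_pt {f : Base → ℝ} (hf : ContDiffOn ℝ ∞ f (strip I)) :
    ContDiffOn ℝ ∞ (pt f) (strip I) := contDiffOn_partialD hf _

theorem contDiffOn_px {f : Base → ℝ} (hf : ContDiffOn ℝ ∞ f (strip I)) :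
    ContDiffOn ℝ ∞ (px f) (strip I) := contDiffOn_partialD hf _

theorem contDiffOn_pv {f : Base → ℝ} (hf : ContDiffOn ℝ ∞ f (strip I)) :
    ContDiffOn ℝ ∞ (pv f) (strip I) := contDiffOn_partialD hf _

/-- Functions that agree on the strip have the same partial derivatives there. -/
theorem partialD_congr {f g : Base → ℝ} (hfg : ∀ p ∈ strip I, f p = g p) {p : Base}
    (hp : p ∈ strip I) (w : Base) : partialD w f p = partialD w g p := by
  apply Filter.EventuallyEq.deriv_eq
  have hc : ContinuousAt (fun s : ℝ => p + s • w) 0 := by fun_prop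
  have hm : strip I ∈ nhds (p + (0 : ℝ) • w) := (isOpen_strip I).mem_nhds (by simpa using hp)
  filter_upwards [hc hm] with s hs
  exact hfg _ hs

theorem partialD_const (w p : Base) (r : ℝ) : partialD w (fun _ => r) p = 0 := by
  simp [partialD, lineDeriv]

theorem partialD_eq_zero_of_eqOn_zero {f : Base → ℝ} (hf : ∀ p ∈ strip I, f p = 0) {p : Base}
    (hp : p ∈ strip I) (w : Base) : partialD w f p = 0 := by
  rw [partialD_congr hf hp, partialD_const]

/-- Symmetry of second derivatives. -/
theorem partialD_comm {f : Base → ℝ} (hf : ContDiffOn ℝ ∞ f (strip I)) {p : Base}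
    (hp : p ∈ strip I) (w w' : Base) :
    partialD w (partialD w' f) p = partialD w' (partialD w f) p := by
  have hfp := hf.contDiffAt ((isOpen_strip I).mem_nhds hp)
  have hd : DifferentiableAt ℝ (fderiv ℝ f) p :=
    (hfp.fderiv_right (m := ∞) (by simp)).differentiableAt (by simp)
  have key : ∀ w w', partialD w (partialD w' f) p = fderiv ℝ (fderiv ℝ f) p w w' := by
    intro w w'
    rw [partialD_congr (fun q hq => partialD_eq_fderiv hf hq w') hp,
      partialD, DifferentiableAt.lineDeriv_eq_fderiv (by fun_prop),
      fderiv_clm_apply hd (by fun_prop)]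
    simp
  rw [key, key]
  have h2 : (2 : WithTop ℕ∞) ≤ ∞ := WithTop.coe_le_coe.2 (le_top (a := (2 : ℕ∞)))
  exact (hfp.isSymmSndFDerivAt (by simpa using h2)).eq w w'

theorem pv_px_comm {f : Base → ℝ} (hf : ContDiffOn ℝ ∞ f (strip I)) {p : Base}
    (hp : p ∈ strip I) : pv (px f) p = px (pv f) p := partialD_comm hf hp _ _

theorem pv_pt_comm {f : Base → ℝ} (hf : ContDiffOn ℝ ∞ f (strip I)) {p : Base}
    (hp : p ∈ strip I) : pv (pt f) p = pt (pv f) p := partialD_comm hf hp _ _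

theorem px_pt_comm {f : Base → ℝ} (hf : ContDiffOn ℝ ∞ f (strip I)) {p : Base}
    (hp : p ∈ strip I) : px (pt f) p = pt (px f) p := partialD_comm hf hp _ _

theorem hasDerivAt_comp_curve {f : Base → ℝ} (hf : ContDiffOn ℝ ∞ f (strip I)) {γ : ℝ → Base}
    {w : Base} {s : ℝ} (hγ : HasDerivAt γ w s) (hs : γ s ∈ strip I) :
    HasDerivAt (fun r => f (γ r)) (partialD w f (γ s)) s := by
  rw [partialD_eq_fderiv hf hs]
  exact (differentiableAt_of_strip hf hs).hasFDerivAt.comp_hasDerivAt s hγ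

theorem hasDerivAt_pt {f : Base → ℝ} (hf : ContDiffOn ℝ ∞ f (strip I)) {t : ℝ} (ht : t ∈ I)
    (x v : ℝ) : HasDerivAt (fun t => f (t, x, v)) (pt f (t, x, v)) t :=
  hasDerivAt_comp_curve (γ := fun t => (t, x, v)) hf
    ((hasDerivAt_id t).prodMk (hasDerivAt_const t (x, v))) ht

theorem hasDerivAt_px {f : Base → ℝ} (hf : ContDiffOn ℝ ∞ f (strip I)) {t : ℝ} (ht : t ∈ I)
    (x v : ℝ) : HasDerivAt (fun x => f (t, x, v)) (px f (t, x, v)) x :=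
  hasDerivAt_comp_curve (γ := fun x => (t, x, v)) hf
    ((hasDerivAt_const x t).prodMk ((hasDerivAt_id x).prodMk (hasDerivAt_const x v))) ht

theorem hasDerivAt_pv {f : Base → ℝ} (hf : ContDiffOn ℝ ∞ f (strip I)) {t : ℝ} (ht : t ∈ I)
    (x v : ℝ) : HasDerivAt (fun v => f (t, x, v)) (pv f (t, x, v)) v :=
  hasDerivAt_comp_curve (γ := fun v => (t, x, v)) hf
    ((hasDerivAt_const v t).prodMk ((hasDerivAt_const v x).prodMk (hasDerivAt_id v))) ht

theorem eq_add_mul_of_deriv_eq_const {g : ℝ → ℝ} {m : ℝ} (hg : ∀ s, HasDerivAt g m s) (s : ℝ) :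
    g s = g 0 + m * s := by
  have hd : ∀ r, HasDerivAt (fun r => g r - m * r) (m - m * 1) r := fun r =>
    (hg r).sub ((hasDerivAt_id r).const_mul m)
  have := is_const_of_deriv_eq_zero (fun r => (hd r).differentiableAt)
    (fun r => by rw [(hd r).deriv]; ring) s 0
  linarith

theorem eq_of_px_eq_zero {f : Base → ℝ} (hf : ContDiffOn ℝ ∞ f (strip I))
    (h0 : ∀ p ∈ strip I, px f p = 0) {t : ℝ} (ht : t ∈ I) (x v : ℝ) :
    f (t, x, v) = f (t, 0, v) := by
  have := eq_add_mul_of_deriv_eq_const (g := fun x => f (t, x, v)) (m := 0)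
    (fun x => h0 (t, x, v) ht ▸ hasDerivAt_px hf ht x v) x
  simpa using this

theorem eq_of_pv_eq_zero {f : Base → ℝ} (hf : ContDiffOn ℝ ∞ f (strip I))
    (h0 : ∀ p ∈ strip I, pv f p = 0) {t : ℝ} (ht : t ∈ I) (x v : ℝ) :
    f (t, x, v) = f (t, x, 0) := by
  have := eq_add_mul_of_deriv_eq_const (g := fun v => f (t, x, v)) (m := 0)
    (fun v => h0 (t, x, v) ht ▸ hasDerivAt_pv hf ht x v) v
  simpa using this

theorem lineDeriv_comp_base {f : Base → ℝ} (hf : ContDiffOn ℝ ∞ f (strip I)) {j : Jet}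
    (hj : j.1 ∈ I) (w : Jet) : lineDeriv ℝ (fun j : Jet => f j.base) j w
      = w.1 * pt f j.base + w.2.1 * px f j.base + w.2.2 0 0 * pv f j.base := by
  have hp : j.base ∈ strip I := hj
  have h1 : lineDeriv ℝ (fun j : Jet => f j.base) j w = partialD w.base f j.base := rfl
  have h2 : w.base = w.1 • ((1, 0, 0) : Base) + w.2.1 • ((0, 1, 0) : Base)
      + w.2.2 0 0 • ((0, 0, 1) : Base) := by simp [Jet.base]
  simp only [h1, pt, px, pv, partialD_eq_fderiv hf hp]
  rw [h2]
  simp only [map_add, map_smul, smul_eq_mul]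

theorem totalDx_comp_base {f : Base → ℝ} (hf : ContDiffOn ℝ ∞ f (strip I)) {j : Jet}
    (hj : j.1 ∈ I) :
    totalDx (fun j => f j.base) j = px f j.base + pv f j.base * j.2.2 0 1 := by
  simpa [mul_comm, totalDx] using lineDeriv_comp_base hf hj (0, 1, fun a b => j.2.2 a (b + 1))

theorem totalDt_comp_base {f : Base → ℝ} (hf : ContDiffOn ℝ ∞ f (strip I)) {j : Jet}
    (hj : j.1 ∈ I) :
    totalDt (fun j => f j.base) j = pt f j.base + pv f j.base * j.2.2 1 0 := by
  simpa [mul_comm, totalDt] using lineDeriv_comp_base hf hj (1, 0, fun a b => j.2.2 (a + 1) b)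

/-! ### The prolongation of a vector field -/

/-- The `∂_t` component of a vector field. -/
def tau (V : SmoothField I) (p : Base) : ℝ := (V.1 p).1

/-- The `∂_x` component of a vector field. -/
def xi (V : SmoothField I) (p : Base) : ℝ := (V.1 p).2.1

/-- The `∂_v` component of a vector field. -/
def eta (V : SmoothField I) (p : Base) : ℝ := (V.1 p).2.2

theorem contDiffOn_tau (V : SmoothField I) : ContDiffOn ℝ ∞ (tau V) (strip I) := V.2.1.fst

theorem contDiffOn_xi (V : SmoothField I) : ContDiffOn ℝ ∞ (xi V) (strip I) := V.2.1.snd.fst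

theorem contDiffOn_eta (V : SmoothField I) : ContDiffOn ℝ ∞ (eta V) (strip I) := V.2.1.snd.snd

/-- A function on the base, as a differential function. -/
def lift (f : Base → ℝ) (j : Jet) : ℝ := f j.base

theorem isSmooth_lift {f : Base → ℝ} (hf : ContDiffOn ℝ ∞ f (strip I)) : IsSmooth I (lift f) :=
  isSmooth_comp_base hf

theorem iterate_two_totalDx_mul_jetVar {F : Jet → ℝ} (hF : IsSmooth I F) (a b : ℕ) {j : Jet}
    (hj : j.1 ∈ I) :
    totalDx^[2] (F * jetVar a b) j = totalDx^[2] F j * j.2.2 a b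
      + 2 * totalDx F j * j.2.2 a (b + 1) + F j * j.2.2 a (b + 2) := by
  rw [iterate_totalDx_succ_mul_jetVar hF 1 a b hj,
    iterate_totalDx_succ_mul_jetVar hF.totalDx 0 a b hj,
    iterate_totalDx_succ_mul_jetVar hF 0 a (b + 1) hj]
  simp only [Function.iterate_succ_apply, Function.iterate_zero, id, Pi.mul_apply, jetVar]
  ring

theorem iterate_four_totalDx_mul_jetVar {F : Jet → ℝ} (hF : IsSmooth I F) (a b : ℕ) {j : Jet}
    (hj : j.1 ∈ I) :
    totalDx^[4] (F * jetVar a b) j = totalDx^[4] F j * j.2.2 a b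
      + 4 * totalDx^[3] F j * j.2.2 a (b + 1) + 6 * totalDx^[2] F j * j.2.2 a (b + 2)
      + 4 * totalDx F j * j.2.2 a (b + 3) + F j * j.2.2 a (b + 4) := by
  rw [iterate_totalDx_succ_mul_jetVar hF 3 a b hj,
    iterate_totalDx_succ_mul_jetVar hF.totalDx 2 a b hj,
    iterate_totalDx_succ_mul_jetVar hF 2 a (b + 1) hj,
    iterate_two_totalDx_mul_jetVar hF.totalDx.totalDx a b hj,
    iterate_two_totalDx_mul_jetVar hF.totalDx a (b + 1) hj,
    iterate_two_totalDx_mul_jetVar hF a (b + 2) hj]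
  simp only [Function.iterate_succ_apply, Function.iterate_zero, id]
  ring

theorem characteristic_eq (V : SmoothField I) : characteristic V.1
    = lift (eta V) - lift (tau V) * jetVar 1 0 - lift (xi V) * jetVar 0 1 := rfl

theorem totalDx_lift {f : Base → ℝ} (hf : ContDiffOn ℝ ∞ f (strip I)) {j : Jet} (hj : j.1 ∈ I) :
    totalDx (lift f) j = (lift (px f) + lift (pv f) * jetVar 0 1) j :=
  totalDx_comp_base hf hj

theorem totalDt_totalDx_lift {f : Base → ℝ} (hf : ContDiffOn ℝ ∞ f (strip I)) {j : Jet}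
    (hj : j.1 ∈ I) :
    totalDt (totalDx (lift f)) j = pt (px f) j.base + pv (px f) j.base * j.2.2 1 0
      + (pt (pv f) j.base + pv (pv f) j.base * j.2.2 1 0) * j.2.2 0 1
      + pv f j.base * j.2.2 1 1 := by
  have hx := contDiffOn_px hf
  have hv := contDiffOn_pv hf
  have h1 := totalDt_comp_base hx hj
  have h2 := totalDt_comp_base hv hj
  unfold totalDt at *
  rw [lineDeriv_jet_congr (fun j hj => totalDx_lift hf hj) hj,
    lineDeriv_jet_add (isSmooth_lift hx) ((isSmooth_lift hv).mul (isSmooth_jetVar 0 1)) hj,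
    lineDeriv_jet_mul (isSmooth_lift hv) (isSmooth_jetVar 0 1) hj, lineDeriv_jetVar]
  unfold lift jetVar
  rw [h1, h2]
  ring

theorem prolongCoeff_zero_zero (V : SmoothField I) (j : Jet) :
    prolongCoeff V.1 0 0 j = eta V j.base := by
  simp only [prolongCoeff, characteristic, eta, Function.iterate_zero, id]
  ring

theorem iterate_totalDx_characteristic (V : SmoothField I) (n : ℕ) {j : Jet} (hj : j.1 ∈ I) :
    totalDx^[n] (characteristic V.1) j = totalDx^[n] (lift (eta V)) j
      - totalDx^[n] (lift (tau V) * jetVar 1 0) j - totalDx^[n] (lift (xi V) * jetVar 0 1) j := by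
  have ht := isSmooth_lift (contDiffOn_tau V)
  have hx := isSmooth_lift (contDiffOn_xi V)
  have hn := isSmooth_lift (contDiffOn_eta V)
  rw [characteristic_eq, iterate_totalDx_sub (hn.sub (ht.mul (isSmooth_jetVar 1 0)))
    (hx.mul (isSmooth_jetVar 0 1)) n hj, iterate_totalDx_sub hn (ht.mul (isSmooth_jetVar 1 0)) n hj]

theorem prolongCoeff_zero_one (V : SmoothField I) {j : Jet} (hj : j.1 ∈ I) :
    prolongCoeff V.1 0 1 j = totalDx (lift (eta V)) j - totalDx (lift (tau V)) j * j.2.2 1 0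
      - totalDx (lift (xi V)) j * j.2.2 0 1 := by
  have ht := isSmooth_lift (contDiffOn_tau V)
  have hx := isSmooth_lift (contDiffOn_xi V)
  rw [prolongCoeff, Function.iterate_zero, id, iterate_totalDx_characteristic V 1 hj,
    iterate_totalDx_succ_mul_jetVar ht 0 1 0 hj, iterate_totalDx_succ_mul_jetVar hx 0 0 1 hj]
  simp only [Function.iterate_succ_apply, Function.iterate_zero, id, Pi.mul_apply, jetVar, lift,
    tau, xi]
  ring

theorem prolongCoeff_zero_two (V : SmoothField I) {j : Jet} (hj : j.1 ∈ I) :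
    prolongCoeff V.1 0 2 j = totalDx^[2] (lift (eta V)) j
      - totalDx^[2] (lift (tau V)) j * j.2.2 1 0 - 2 * totalDx (lift (tau V)) j * j.2.2 1 1
      - totalDx^[2] (lift (xi V)) j * j.2.2 0 1 - 2 * totalDx (lift (xi V)) j * j.2.2 0 2 := by
  have ht := isSmooth_lift (contDiffOn_tau V)
  have hx := isSmooth_lift (contDiffOn_xi V)
  rw [prolongCoeff, Function.iterate_zero, id, iterate_totalDx_characteristic V 2 hj,
    iterate_two_totalDx_mul_jetVar ht 1 0 hj, iterate_two_totalDx_mul_jetVar hx 0 1 hj]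
  simp only [lift, tau, xi]
  ring

theorem prolongCoeff_zero_four (V : SmoothField I) {j : Jet} (hj : j.1 ∈ I) :
    prolongCoeff V.1 0 4 j = totalDx^[4] (lift (eta V)) j
      - totalDx^[4] (lift (tau V)) j * j.2.2 1 0 - 4 * totalDx^[3] (lift (tau V)) j * j.2.2 1 1
      - 6 * totalDx^[2] (lift (tau V)) j * j.2.2 1 2 - 4 * totalDx (lift (tau V)) j * j.2.2 1 3
      - totalDx^[4] (lift (xi V)) j * j.2.2 0 1 - 4 * totalDx^[3] (lift (xi V)) j * j.2.2 0 2
      - 6 * totalDx^[2] (lift (xi V)) j * j.2.2 0 3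
      - 4 * totalDx (lift (xi V)) j * j.2.2 0 4 := by
  have ht := isSmooth_lift (contDiffOn_tau V)
  have hx := isSmooth_lift (contDiffOn_xi V)
  rw [prolongCoeff, Function.iterate_zero, id, iterate_totalDx_characteristic V 4 hj,
    iterate_four_totalDx_mul_jetVar ht 1 0 hj, iterate_four_totalDx_mul_jetVar hx 0 1 hj]
  simp only [lift, tau, xi]
  ring

theorem prolongCoeff_one_one (V : SmoothField I) {j : Jet} (hj : j.1 ∈ I) :
    prolongCoeff V.1 1 1 j = totalDt (totalDx (lift (eta V))) j
      - totalDt (totalDx (lift (tau V))) j * j.2.2 1 0 - totalDx (lift (tau V)) j * j.2.2 2 0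
      - totalDt (lift (tau V)) j * j.2.2 1 1
      - totalDt (totalDx (lift (xi V))) j * j.2.2 0 1 - totalDx (lift (xi V)) j * j.2.2 1 1
      - totalDt (lift (xi V)) j * j.2.2 0 2 := by
  have ht := isSmooth_lift (contDiffOn_tau V)
  have hx := isSmooth_lift (contDiffOn_xi V)
  have hn := isSmooth_lift (contDiffOn_eta V)
  have expand : ∀ j : Jet, j.1 ∈ I → totalDx (characteristic V.1) j
      = (totalDx (lift (eta V))
        - (totalDx (lift (tau V)) * jetVar 1 0 + lift (tau V) * jetVar 1 1)
        - (totalDx (lift (xi V)) * jetVar 0 1 + lift (xi V) * jetVar 0 2)) j := fun j hj => by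
    have := iterate_totalDx_characteristic V 1 hj
    rwa [iterate_totalDx_succ_mul_jetVar ht 0 1 0 hj,
      iterate_totalDx_succ_mul_jetVar hx 0 0 1 hj] at this
  have c := isSmooth_jetVar (I := I)
  rw [prolongCoeff, Function.iterate_one, Function.iterate_one, totalDt,
    lineDeriv_jet_congr expand hj,
    lineDeriv_jet_sub (hn.totalDx.sub ((ht.totalDx.mul (c 1 0)).add (ht.mul (c 1 1))))
      ((hx.totalDx.mul (c 0 1)).add (hx.mul (c 0 2))) hj,
    lineDeriv_jet_sub hn.totalDx ((ht.totalDx.mul (c 1 0)).add (ht.mul (c 1 1))) hj,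
    lineDeriv_jet_add (ht.totalDx.mul (c 1 0)) (ht.mul (c 1 1)) hj,
    lineDeriv_jet_add (hx.totalDx.mul (c 0 1)) (hx.mul (c 0 2)) hj,
    lineDeriv_jet_mul ht.totalDx (c 1 0) hj, lineDeriv_jet_mul ht (c 1 1) hj,
    lineDeriv_jet_mul hx.totalDx (c 0 1) hj, lineDeriv_jet_mul hx (c 0 2) hj]
  simp only [lineDeriv_jetVar, totalDt, jetVar, lift, tau, xi]
  ring

/-- The partial derivative `h_x(x, t)` of the forcing. -/
def forcingX (h : ℝ → ℝ → ℝ) (x t : ℝ) : ℝ := deriv (fun y => h y t) x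

/-- The partial derivative `h_t(x, t)` of the forcing. -/
def forcingT (h : ℝ → ℝ → ℝ) (x t : ℝ) : ℝ := deriv (fun s => h x s) t

theorem hasFDerivAt_forcing {h : ℝ → ℝ → ℝ}
    (hh : ContDiffOn ℝ ∞ (fun p : ℝ × ℝ => h p.1 p.2) (Set.univ ×ˢ (I : Set ℝ))) (x : ℝ) {t : ℝ}
    (ht : t ∈ I) : HasFDerivAt (fun p : ℝ × ℝ => h p.1 p.2)
      (fderiv ℝ (fun p : ℝ × ℝ => h p.1 p.2) (x, t)) (x, t) :=
  ((hh.contDiffAt ((isOpen_univ.prod I.isOpen).mem_nhds ⟨trivial, ht⟩)).differentiableAt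
    (by simp)).hasFDerivAt

theorem hasDerivAt_forcing_curve {h : ℝ → ℝ → ℝ}
    (hh : ContDiffOn ℝ ∞ (fun p : ℝ × ℝ => h p.1 p.2) (Set.univ ×ˢ (I : Set ℝ)))
    {y z : ℝ → ℝ} {y' z' s : ℝ} (hy : HasDerivAt y y' s) (hz : HasDerivAt z z' s)
    (hs : z s ∈ I) :
    HasDerivAt (fun r => h (y r) (z r))
      (y' * forcingX h (y s) (z s) + z' * forcingT h (y s) (z s)) s := by
  have hF := hasFDerivAt_forcing hh (y s) hs
  have h1 : forcingX h (y s) (z s) = fderiv ℝ (fun p : ℝ × ℝ => h p.1 p.2) (y s, z s) (1, 0) :=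
    (HasFDerivAt.comp_hasDerivAt (y s) (f := fun r => (r, z s)) hF
      ((hasDerivAt_id _).prodMk (hasDerivAt_const _ _))).deriv
  have h2 : forcingT h (y s) (z s) = fderiv ℝ (fun p : ℝ × ℝ => h p.1 p.2) (y s, z s) (0, 1) :=
    (HasFDerivAt.comp_hasDerivAt (z s) (f := fun r => (y s, r)) hF
      ((hasDerivAt_const _ _).prodMk (hasDerivAt_id _))).deriv
  have h3 : ((y', z') : ℝ × ℝ) = y' • ((1, 0) : ℝ × ℝ) + z' • ((0, 1) : ℝ × ℝ) := by simp
  have := HasFDerivAt.comp_hasDerivAt s (f := fun r => (y r, z r)) hF (hy.prodMk hz)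
  rw [h3, map_add, map_smul, map_smul, ← h1, ← h2] at this
  exact this

theorem prolong_potentialEq {h : ℝ → ℝ → ℝ} (α β : ℝ)
    (hh : ContDiffOn ℝ ∞ (fun p : ℝ × ℝ => h p.1 p.2) (Set.univ ×ˢ (I : Set ℝ)))
    (V : SmoothField I) {j : Jet} (hj : j.1 ∈ I) :
    prolong 4 V.1 (potentialEq α β h) j = prolongCoeff V.1 1 1 j
      + (prolongCoeff V.1 0 1 j * j.2.2 0 2 + j.2.2 0 1 * prolongCoeff V.1 0 2 j)
      + α * prolongCoeff V.1 0 4 j - β * eta V j.base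
      - (xi V j.base * forcingX h j.2.1 j.1 + tau V j.base * forcingT h j.2.1 j.1) := by
  have hl : ∀ a b : ℝ, HasDerivAt (fun s : ℝ => a + s * b) b 0 := fun a b => by
    simpa using ((hasDerivAt_id (0 : ℝ)).mul_const b).const_add a
  have hF := hasDerivAt_forcing_curve hh (hl j.2.1 (xi V j.base)) (hl j.1 (tau V j.base))
    (by simpa using hj)
  have key := ((((hl (j.2.2 1 1) (prolongCoeff V.1 1 1 j)).add
    ((hl (j.2.2 0 1) (prolongCoeff V.1 0 1 j)).mul (hl (j.2.2 0 2) (prolongCoeff V.1 0 2 j)))).add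
    ((hl (j.2.2 0 4) (prolongCoeff V.1 0 4 j)).const_mul α)).sub
    ((hl (j.2.2 0 0) (prolongCoeff V.1 0 0 j)).const_mul β)).sub hF
  have := key.deriv
  simp only [zero_mul, add_zero] at this
  rw [← prolongCoeff_zero_zero, ← this]
  simp only [prolong, lineDeriv]
  congr 1

/-! ### The determining equations -/

/-- The differential function `F` depends only on `t`, `x` and the pure `x`-derivatives of `v`. -/
def DependsOnX (F : Jet → ℝ) : Prop :=
  ∀ j j' : Jet, j.1 = j'.1 → j.2.1 = j'.2.1 → (∀ b, j.2.2 0 b = j'.2.2 0 b) → F j = F j'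

theorem dependsOnX_lift (f : Base → ℝ) : DependsOnX (lift f) := fun j j' ht hx hu => by
  simp [lift, Jet.base, ht, hx, hu]

theorem DependsOnX.totalDx {F : Jet → ℝ} (hF : DependsOnX F) : DependsOnX (totalDx F) := by
  intro j j' ht hx hu
  refine congrArg (fun g => deriv g (0 : ℝ)) (funext fun s => hF _ _ ?_ ?_ fun b => ?_)
  · simpa using ht
  · simpa using hx
  · simp [hu]

theorem DependsOnX.iterate_totalDx {F : Jet → ℝ} (hF : DependsOnX F) :
    ∀ n : ℕ, DependsOnX (Ostrovsky.totalDx^[n] F)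
  | 0 => hF
  | n + 1 => DependsOnX.iterate_totalDx hF.totalDx n

/-- The jet over `(t, x)` with `∂_x ^ n v = a n`, `∂_t ∂_x ^ n v = b n` and all other jet variables
zero. -/
def jetOf (t x : ℝ) (a b : ℕ → ℝ) : Jet :=
  (t, x, fun m n => match m with
    | 0 => a n
    | 1 => b n
    | _ => 0)

theorem iterate_totalDx_lift_jetOf (f : Base → ℝ) (n : ℕ) (t x : ℝ) (a b : ℕ → ℝ) :
    totalDx^[n] (lift f) (jetOf t x a b) = totalDx^[n] (lift f) (jetOf t x a 0) :=
  (dependsOnX_lift f).iterate_totalDx n _ _ rfl rfl fun _ => rfl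

theorem totalDx_lift_jetOf (f : Base → ℝ) (t x : ℝ) (a b : ℕ → ℝ) :
    totalDx (lift f) (jetOf t x a b) = totalDx (lift f) (jetOf t x a 0) :=
  iterate_totalDx_lift_jetOf f 1 t x a b

/-- The symmetry condition on the jets `jetOf t x a b`. The variables `b n` occur only where they
are displayed. -/
theorem symmetry_identity {α β : ℝ} {h : ℝ → ℝ → ℝ}
    (hh : ContDiffOn ℝ ∞ (fun p : ℝ × ℝ => h p.1 p.2) (Set.univ ×ˢ (I : Set ℝ)))
    {V : SmoothField I} (hV : V ∈ pointSymmetries I α β h) {t : ℝ} (ht : t ∈ I) (x : ℝ)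
    (a b : ℕ → ℝ) (hb : b 1 + a 1 * a 2 + α * a 4 - β * a 0 - h x t = 0) {p : Base}
    (hp : p = (t, x, a 0)) {J : Jet} (hJ : J = jetOf t x a 0) :
    (pt (px (eta V)) p + pv (px (eta V)) p * b 0
        + (pt (pv (eta V)) p + pv (pv (eta V)) p * b 0) * a 1 + pv (eta V) p * b 1
      - (pt (px (tau V)) p + pv (px (tau V)) p * b 0
        + (pt (pv (tau V)) p + pv (pv (tau V)) p * b 0) * a 1 + pv (tau V) p * b 1) * b 0
      - (pt (tau V) p + pv (tau V) p * b 0) * b 1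
      - (pt (px (xi V)) p + pv (px (xi V)) p * b 0
        + (pt (pv (xi V)) p + pv (pv (xi V)) p * b 0) * a 1 + pv (xi V) p * b 1) * a 1
      - totalDx (lift (xi V)) J * b 1 - (pt (xi V) p + pv (xi V) p * b 0) * a 2)
    + (totalDx (lift (eta V)) J - totalDx (lift (tau V)) J * b 0
      - totalDx (lift (xi V)) J * a 1) * a 2
    + a 1 * (totalDx^[2] (lift (eta V)) J - totalDx^[2] (lift (tau V)) J * b 0
      - 2 * totalDx (lift (tau V)) J * b 1 - totalDx^[2] (lift (xi V)) J * a 1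
      - 2 * totalDx (lift (xi V)) J * a 2)
    + α * (totalDx^[4] (lift (eta V)) J - totalDx^[4] (lift (tau V)) J * b 0
      - 4 * totalDx^[3] (lift (tau V)) J * b 1 - 6 * totalDx^[2] (lift (tau V)) J * b 2
      - 4 * totalDx (lift (tau V)) J * b 3 - totalDx^[4] (lift (xi V)) J * a 1
      - 4 * totalDx^[3] (lift (xi V)) J * a 2 - 6 * totalDx^[2] (lift (xi V)) J * a 3
      - 4 * totalDx (lift (xi V)) J * a 4)
    - β * eta V p - (xi V p * forcingX h x t + tau V p * forcingT h x t) = 0 := by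
  subst hp hJ
  have hj : (jetOf t x a b).1 ∈ I := ht
  have key := hV (jetOf t x a b) hj hb
  have hτ := contDiffOn_tau V
  have hξ := contDiffOn_xi V
  have hη := contDiffOn_eta V
  have e1 : totalDt (lift (tau V)) (jetOf t x a b) = _ := totalDt_comp_base hτ hj
  have e2 : totalDt (lift (xi V)) (jetOf t x a b) = _ := totalDt_comp_base hξ hj
  rw [prolong_potentialEq α β hh V hj, prolongCoeff_one_one V hj, prolongCoeff_zero_one V hj,
    prolongCoeff_zero_two V hj, prolongCoeff_zero_four V hj, totalDt_totalDx_lift hτ hj,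
    totalDt_totalDx_lift hξ hj, totalDt_totalDx_lift hη hj, e1, e2] at key
  simp only [iterate_totalDx_lift_jetOf _ _ t x a b, totalDx_lift_jetOf _ t x a b] at key
  simp only [jetOf, Jet.base, mul_zero, sub_zero] at key ⊢
  linarith

theorem iterate_totalDx_eq_zero {F : Jet → ℝ} (hF : ∀ j : Jet, j.1 ∈ I → F j = 0) (n : ℕ)
    {j : Jet} (hj : j.1 ∈ I) : totalDx^[n] F j = 0 := by
  induction n generalizing F with
  | zero => exact hF j hj
  | succ n ih =>
    refine ih fun j hj => (lineDeriv_jet_congr (G := fun _ => 0) hF hj _).trans ?_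
    simp [lineDeriv]

/-- The coefficient of `v_txxx` in the symmetry condition is `-4 α D_x τ`. -/
theorem px_tau_eq_zero {α β : ℝ} (hα : α ≠ 0) {h : ℝ → ℝ → ℝ}
    (hh : ContDiffOn ℝ ∞ (fun p : ℝ × ℝ => h p.1 p.2) (Set.univ ×ˢ (I : Set ℝ)))
    {V : SmoothField I} (hV : V ∈ pointSymmetries I α β h) {p : Base} (hp : p ∈ strip I) :
    px (tau V) p = 0 ∧ pv (tau V) p = 0 := by
  have key : ∀ r : ℝ, px (tau V) p + pv (tau V) p * r = 0 := by
    intro r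
    obtain ⟨t, x, v⟩ := p
    set a : ℕ → ℝ := fun n => if n = 0 then v else if n = 1 then r else 0 with ha
    set w : ℝ := β * v + h x t with hw
    -- Two solution jets that differ only in `v_txxx`.
    have e0 := symmetry_identity hh hV hp x a (fun n => if n = 1 then w else 0)
      (by simp [ha, hw]) (p := (t, x, v)) (by simp [ha]) rfl
    have e1 := symmetry_identity hh hV hp x a
      (fun n => if n = 1 then w else if n = 3 then 1 else 0)
      (by simp [ha, hw]) (p := (t, x, v)) (by simp [ha]) rfl
    have hD := totalDx_lift (contDiffOn_tau V) (j := jetOf t x a 0) hp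
    have hD' : (lift (px (tau V)) + lift (pv (tau V)) * jetVar 0 1) (jetOf t x a 0)
      = px (tau V) (t, x, v) + pv (tau V) (t, x, v) * r := rfl
    rw [hD'] at hD
    norm_num at e0 e1
    have : α * (4 * totalDx (lift (tau V)) (jetOf t x a 0)) = 0 := by linarith
    rw [← hD]
    simpa [hα] using this
  have h0 := key 0
  have h1 := key 1
  constructor <;> linarith

theorem totalDx_lift_tau_eq_zero {α β : ℝ} (hα : α ≠ 0) {h : ℝ → ℝ → ℝ}
    (hh : ContDiffOn ℝ ∞ (fun p : ℝ × ℝ => h p.1 p.2) (Set.univ ×ˢ (I : Set ℝ)))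
    {V : SmoothField I} (hV : V ∈ pointSymmetries I α β h) (j : Jet) (hj : j.1 ∈ I) :
    totalDx (lift (tau V)) j = 0 := by
  have := px_tau_eq_zero hα hh hV (p := j.base) hj
  rw [totalDx_lift (contDiffOn_tau V) hj]
  simp [lift, this.1, this.2]

/-- Comparison of the terms with `v_t`, the `∂_t` component being independent of `x` and `v`. -/
theorem affine_in_v {α β : ℝ} (hα : α ≠ 0) {h : ℝ → ℝ → ℝ}
    (hh : ContDiffOn ℝ ∞ (fun p : ℝ × ℝ => h p.1 p.2) (Set.univ ×ˢ (I : Set ℝ)))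
    {V : SmoothField I} (hV : V ∈ pointSymmetries I α β h) {p : Base} (hp : p ∈ strip I) :
    pv (xi V) p = 0 ∧ pv (px (eta V)) p = 0 ∧ pv (pv (eta V)) p = pv (px (xi V)) p := by
  have key : ∀ r s : ℝ, pv (px (eta V)) p + pv (pv (eta V)) p * r - pv (xi V) p * s
      - (pv (px (xi V)) p + pv (pv (xi V)) p * r) * r = 0 := by
    intro r s
    obtain ⟨t, x, v⟩ := p
    set a : ℕ → ℝ := fun n => if n = 0 then v else if n = 1 then r else if n = 2 then s else 0
      with ha
    set w : ℝ := β * v + h x t - r * s with hw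
    -- Two solution jets that differ only in `v_t`.
    have e0 := symmetry_identity hh hV hp x a (fun n => if n = 1 then w else 0)
      (by simp [ha, hw]) (p := (t, x, v)) (by simp [ha]) rfl
    have e1 := symmetry_identity hh hV hp x a
      (fun n => if n = 1 then w else if n = 0 then 1 else 0)
      (by simp [ha, hw]) (p := (t, x, v)) (by simp [ha]) rfl
    have hτ := totalDx_lift_tau_eq_zero hα hh hV
    have z : ∀ n, totalDx^[n + 1] (lift (tau V)) (jetOf t x a 0) = 0 := fun n =>
      iterate_totalDx_eq_zero hτ n hp
    have z0 : ∀ w : Base, partialD w (px (tau V)) (t, x, v) = 0 := fun w =>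
      partialD_eq_zero_of_eqOn_zero (fun q hq => (px_tau_eq_zero hα hh hV hq).1) hp w
    have z1 : ∀ w : Base, partialD w (pv (tau V)) (t, x, v) = 0 := fun w =>
      partialD_eq_zero_of_eqOn_zero (fun q hq => (px_tau_eq_zero hα hh hV hq).2) hp w
    rw [hτ (jetOf t x a 0) hp, z 1, z 2, z 3, (px_tau_eq_zero hα hh hV hp).2, pt, pv, z0, z0, z1,
      z1] at e0 e1
    have a0 : a 0 = v := rfl
    have a1 : a 1 = r := rfl
    have a2 : a 2 = s := rfl
    rw [a1, a2] at e0 e1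
    norm_num at e0 e1
    linarith
  have h0 := key 0 0
  have h1 := key 0 1
  have h2 := key 1 0
  have h3 := key (-1) 0
  refine ⟨by linarith, by linarith, by linarith⟩

/-- The `x`-derivatives of a function that does not depend on `v`. -/
theorem iterate_totalDx_lift_of_pv_eq_zero (n : ℕ) {f : Base → ℝ}
    (hf : ContDiffOn ℝ ∞ f (strip I)) (hv : ∀ p ∈ strip I, pv f p = 0) {j : Jet} (hj : j.1 ∈ I) :
    totalDx^[n] (lift f) j = px^[n] f j.base := by
  induction n generalizing f with
  | zero => rfl
  | succ n ih =>
    rw [Function.iterate_succ_apply, Function.iterate_succ_apply,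
      ← ih (contDiffOn_px hf) fun p hp => by
        rw [pv_px_comm hf hp]; exact partialD_eq_zero_of_eqOn_zero hv hp _]
    refine iterate_totalDx_congr (fun j hj => ?_) n j hj
    rw [totalDx_lift hf hj]
    have : pv f j.base = 0 := hv _ hj
    simp [lift, this]

theorem iterate_totalDx_mul_jetVar_of_totalDx_eq_zero (n a b : ℕ) {F : Jet → ℝ}
    (hF : IsSmooth I F) (hv : ∀ j : Jet, j.1 ∈ I → totalDx F j = 0) {j : Jet} (hj : j.1 ∈ I) :
    totalDx^[n] (F * jetVar a b) j = F j * j.2.2 a (b + n) := by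
  induction n generalizing b with
  | zero => rfl
  | succ n ih =>
    rw [iterate_totalDx_succ_mul_jetVar hF n a b hj, ih,
      iterate_totalDx_eq_zero (fun j hj => by simp [hv j hj]) n hj, zero_add, add_assoc,
      add_comm 1 n]

/-- The `x`-derivatives of a function `m v + g` with `m` depending on `t` only and `g` on `t` and
`x` only. -/
theorem iterate_totalDx_lift_of_affine (n : ℕ) {f : Base → ℝ} (hf : ContDiffOn ℝ ∞ f (strip I))
    (hx : ∀ p ∈ strip I, pv (px f) p = 0) (hv : ∀ p ∈ strip I, pv (pv f) p = 0) {j : Jet}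
    (hj : j.1 ∈ I) :
    totalDx^[n + 1] (lift f) j = px^[n + 1] f j.base + pv f j.base * j.2.2 0 (n + 1) := by
  have hfx := contDiffOn_px hf
  have hfv := contDiffOn_pv hf
  have hx' : ∀ p ∈ strip I, px (pv f) p = 0 := fun p hp => by
    rw [← hx p hp, pv_px_comm hf hp]
  have hD : ∀ j : Jet, j.1 ∈ I → totalDx (lift (pv f)) j = 0 := fun j hj => by
    rw [totalDx_lift hfv hj]
    have h1 : px (pv f) j.base = 0 := hx' _ hj
    have h2 : pv (pv f) j.base = 0 := hv _ hj
    simp [lift, h1, h2]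
  rw [Function.iterate_succ_apply, Function.iterate_succ_apply,
    iterate_totalDx_congr (fun j hj => totalDx_lift hf hj) n j hj,
    iterate_totalDx_add (isSmooth_lift hfx) ((isSmooth_lift hfv).mul (isSmooth_jetVar 0 1)) n hj,
    iterate_totalDx_lift_of_pv_eq_zero n hfx hx hj,
    iterate_totalDx_mul_jetVar_of_totalDx_eq_zero n 0 1 (isSmooth_lift hfv) hD hj, add_comm 1 n]
  rfl

/-- The prolonged action on the equation of a field whose components are
`τ(t)`, `ξ(t, x)` and `m(t) v + g(t, x)`. -/
theorem prolong_potentialEq_of_affine (α β : ℝ) {h : ℝ → ℝ → ℝ}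
    (hh : ContDiffOn ℝ ∞ (fun p : ℝ × ℝ => h p.1 p.2) (Set.univ ×ˢ (I : Set ℝ)))
    {V : SmoothField I} (hτx : ∀ p ∈ strip I, px (tau V) p = 0)
    (hτv : ∀ p ∈ strip I, pv (tau V) p = 0) (hξv : ∀ p ∈ strip I, pv (xi V) p = 0)
    (hηx : ∀ p ∈ strip I, pv (px (eta V)) p = 0) (hηv : ∀ p ∈ strip I, pv (pv (eta V)) p = 0)
    {j : Jet} (hj : j.1 ∈ I) {p : Base} (hp : p = j.base) :
    prolong 4 V.1 (potentialEq α β h) j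
      = (pt (px (eta V)) p + pt (pv (eta V)) p * j.2.2 0 1
        + (pv (eta V) p - pt (tau V) p - px (xi V) p) * j.2.2 1 1
        - pt (px (xi V)) p * j.2.2 0 1 - pt (xi V) p * j.2.2 0 2)
      + (px (eta V) p + (pv (eta V) p - px (xi V) p) * j.2.2 0 1) * j.2.2 0 2
      + j.2.2 0 1 * (px^[2] (eta V) p + (pv (eta V) p - 2 * px (xi V) p) * j.2.2 0 2
        - px^[2] (xi V) p * j.2.2 0 1)
      + α * (px^[4] (eta V) p + (pv (eta V) p - 4 * px (xi V) p) * j.2.2 0 4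
        - 6 * px^[2] (xi V) p * j.2.2 0 3 - 4 * px^[3] (xi V) p * j.2.2 0 2
        - px^[4] (xi V) p * j.2.2 0 1)
      - β * eta V p - (xi V p * forcingX h j.2.1 j.1 + tau V p * forcingT h j.2.1 j.1) := by
  subst hp
  have hτ := contDiffOn_tau V
  have hξ := contDiffOn_xi V
  have hη := contDiffOn_eta V
  have hp : j.base ∈ strip I := hj
  have e1 : totalDt (lift (tau V)) j = _ := totalDt_comp_base hτ hj
  have e2 : totalDt (lift (xi V)) j = _ := totalDt_comp_base hξ hj
  have hξxv : pv (px (xi V)) j.base = 0 := by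
    rw [pv_px_comm hξ hp]; exact partialD_eq_zero_of_eqOn_zero hξv hp _
  have zτ : ∀ j : Jet, j.1 ∈ I → totalDx (lift (tau V)) j = 0 := fun j hj => by
    have h1 : px (tau V) j.base = 0 := hτx _ hj
    have h2 : pv (tau V) j.base = 0 := hτv _ hj
    rw [totalDx_lift hτ hj]; simp [lift, h1, h2]
  have zn : ∀ n, totalDx^[n + 1] (lift (tau V)) j = 0 := fun n => iterate_totalDx_eq_zero zτ n hj
  have xn := fun n => iterate_totalDx_lift_of_pv_eq_zero n hξ hξv hj
  have nn := fun n => iterate_totalDx_lift_of_affine n hη hηx hηv hj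
  have x1 : totalDx (lift (xi V)) j = px (xi V) j.base := xn 1
  have n1 : totalDx (lift (eta V)) j = px (eta V) j.base + pv (eta V) j.base * j.2.2 0 1 := nn 0
  have t1 := fun w => partialD_eq_zero_of_eqOn_zero hτx hp w
  have t2 := fun w => partialD_eq_zero_of_eqOn_zero hτv hp w
  have x2 := fun w => partialD_eq_zero_of_eqOn_zero hξv hp w
  rw [prolong_potentialEq α β hh V hj, prolongCoeff_one_one V hj, prolongCoeff_zero_one V hj,
    prolongCoeff_zero_two V hj, prolongCoeff_zero_four V hj, totalDt_totalDx_lift hτ hj,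
    totalDt_totalDx_lift hξ hj, totalDt_totalDx_lift hη hj, e1, e2, zτ j hj, zn 1, zn 2, zn 3,
    x1, n1, xn 2, xn 3, xn 4, nn 1, nn 3, hηx _ hp, hηv _ hp, hτv _ hp, hξv _ hp, hξxv,
    pt, pv, t1, t1, t2, t2, x2, x2]
  ring

/-- The solved determining equations: `τ` is constant, `ξ = ξ(t)`, `η` does not depend on `v`,
`η_x = ξ'` and `η_tx - β η - ξ h_x - τ h_t = 0`. -/
structure Determining (β : ℝ) (h : ℝ → ℝ → ℝ) (V : SmoothField I) (p : Base) : Prop where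
  pt_tau : pt (tau V) p = 0
  px_tau : px (tau V) p = 0
  pv_tau : pv (tau V) p = 0
  px_xi : px (xi V) p = 0
  pv_xi : pv (xi V) p = 0
  pv_eta : pv (eta V) p = 0
  px_eta : px (eta V) p = pt (xi V) p
  remainder : pt (px (eta V)) p - β * eta V p
    - (xi V p * forcingX h p.2.1 p.1 + tau V p * forcingT h p.2.1 p.1) = 0

/-- Comparison of the coefficients of `v_xxx`, `v_xxxx`, `v`, `v_x v_xx`, `v_xx`, `v_x` and `1` in
the reduced symmetry condition, after elimination of `v_tx`. -/
theorem determining_of_mem {α β : ℝ} (hα : α ≠ 0) (hβ : β ≠ 0) {h : ℝ → ℝ → ℝ}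
    (hh : ContDiffOn ℝ ∞ (fun p : ℝ × ℝ => h p.1 p.2) (Set.univ ×ˢ (I : Set ℝ)))
    {V : SmoothField I} (hV : V ∈ pointSymmetries I α β h) {p : Base} (hp : p ∈ strip I) :
    Determining β h V p := by
  have hξ := contDiffOn_xi V
  have hη := contDiffOn_eta V
  have hτx : ∀ p ∈ strip I, px (tau V) p = 0 := fun p hp => (px_tau_eq_zero hα hh hV hp).1
  have hτv : ∀ p ∈ strip I, pv (tau V) p = 0 := fun p hp => (px_tau_eq_zero hα hh hV hp).2
  have hξv : ∀ p ∈ strip I, pv (xi V) p = 0 := fun p hp => (affine_in_v hα hh hV hp).1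
  have hηx : ∀ p ∈ strip I, pv (px (eta V)) p = 0 := fun p hp => (affine_in_v hα hh hV hp).2.1
  have hηv : ∀ p ∈ strip I, pv (pv (eta V)) p = 0 := fun p hp => by
    rw [(affine_in_v hα hh hV hp).2.2, pv_px_comm hξ hp]
    exact partialD_eq_zero_of_eqOn_zero hξv hp _
  have eq : ∀ (p : Base), p ∈ strip I → ∀ a1 a2 a3 a4 : ℝ,
      (pt (px (eta V)) p + pt (pv (eta V)) p * a1
        + (pv (eta V) p - pt (tau V) p - px (xi V) p)
          * (β * p.2.2 + h p.2.1 p.1 - a1 * a2 - α * a4)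
        - pt (px (xi V)) p * a1 - pt (xi V) p * a2)
      + (px (eta V) p + (pv (eta V) p - px (xi V) p) * a1) * a2
      + a1 * (px^[2] (eta V) p + (pv (eta V) p - 2 * px (xi V) p) * a2 - px^[2] (xi V) p * a1)
      + α * (px^[4] (eta V) p + (pv (eta V) p - 4 * px (xi V) p) * a4
        - 6 * px^[2] (xi V) p * a3 - 4 * px^[3] (xi V) p * a2 - px^[4] (xi V) p * a1)
      - β * eta V p - (xi V p * forcingX h p.2.1 p.1 + tau V p * forcingT h p.2.1 p.1) = 0 := by
    rintro ⟨t, x, v⟩ hp a1 a2 a3 a4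
    let a : ℕ → ℝ := fun n => match n with
      | 0 => v
      | 1 => a1
      | 2 => a2
      | 3 => a3
      | _ => a4
    let w : ℝ := β * v + h x t - a1 * a2 - α * a4
    have hj : (jetOf t x a fun _ => w).1 ∈ I := hp
    have hs : potentialEq α β h (jetOf t x a fun _ => w) = 0 := by
      simp only [potentialEq, jetOf, a, w]; ring
    rw [← hV _ hj hs, prolong_potentialEq_of_affine α β hh hτx hτv hξv hηx hηv hj
      (p := (t, x, v)) rfl]
    rfl
  -- The coefficient of `v_xxx` gives `ξ_xx = 0`.
  have hxx : ∀ p ∈ strip I, px (px (xi V)) p = 0 := fun p hp => by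
    have h0 := eq p hp 0 0 0 0
    have h1 := eq p hp 0 0 1 0
    have : α * px^[2] (xi V) p = 0 := by linarith
    simpa [hα] using this
  have hxxx : ∀ p ∈ strip I, px^[3] (xi V) p = 0 := fun p hp =>
    partialD_eq_zero_of_eqOn_zero hxx hp _
  have hxxxx : ∀ p ∈ strip I, px^[4] (xi V) p = 0 := fun p hp =>
    partialD_eq_zero_of_eqOn_zero hxxx hp _
  -- The coefficients of `v_xxxx`, `v_x v_xx`, `v_xx` and `v_x`.
  have alg : ∀ p ∈ strip I, pt (tau V) p = 3 * px (xi V) p ∧ pv (eta V) p = -px (xi V) p ∧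
      px (eta V) p = pt (xi V) p ∧
      pt (pv (eta V)) p - pt (px (xi V)) p + px (px (eta V)) p = 0 := by
    intro p hp
    have h0 := eq p hp 0 0 0 0
    have h1 := eq p hp 0 0 0 1
    have h2 := eq p hp 1 1 0 0
    have h3 := eq p hp 1 0 0 0
    have h4 := eq p hp 0 1 0 0
    have e1 : α * (pt (tau V) p - 3 * px (xi V) p) = 0 := by linarith
    have e2 : pt (tau V) p - 3 * px (xi V) p = 0 := by simpa [hα] using e1
    have e3 : px^[2] (xi V) p = 0 := hxx p hp
    rw [hxxx p hp, hxxxx p hp] at h3 h4 h2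
    rw [e3] at h2 h3 h4
    have e4 : px^[2] (eta V) p = px (px (eta V)) p := rfl
    rw [← e4]
    refine ⟨?_, ?_, ?_, ?_⟩ <;> linarith
  have hηxx : ∀ p ∈ strip I, px (px (eta V)) p = 0 := fun p hp => by
    have h1 := (alg p hp).2.2.2
    have h2 : px (px (eta V)) p = pt (px (xi V)) p := by
      rw [← px_pt_comm hξ hp]
      exact partialD_congr (fun q hq => (alg q hq).2.2.1) hp _
    have h3 : pt (pv (eta V)) p = -pt (px (xi V)) p := by
      refine (partialD_congr (fun q hq => (alg q hq).2.1) hp _).trans ?_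
      simp [pt, partialD, lineDeriv]
    linarith
  have hηxxxx : ∀ p ∈ strip I, px^[4] (eta V) p = 0 := fun p hp =>
    partialD_eq_zero_of_eqOn_zero (fun p hp => partialD_eq_zero_of_eqOn_zero hηxx hp _) hp _
  -- The coefficient of `v`, from the values of the remainder at `v = 0` and `v = 1`.
  have hξx : ∀ p ∈ strip I, px (xi V) p = 0 := by
    rintro ⟨t, x, v⟩ hp
    have hξxv : ∀ p ∈ strip I, pv (px (xi V)) p = 0 := fun p hp => by
      rw [pv_px_comm hξ hp]; exact partialD_eq_zero_of_eqOn_zero hξv hp _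
    have hηtx : ∀ p ∈ strip I, pv (pt (px (eta V))) p = 0 := fun p hp => by
      rw [pv_pt_comm (contDiffOn_px hη) hp]
      exact partialD_eq_zero_of_eqOn_zero hηx hp _
    have ht : t ∈ I := hp
    have hp0 : (t, x, 0) ∈ strip I := hp
    have hp1 : (t, x, 1) ∈ strip I := hp
    have h0 := eq (t, x, 0) hp0 0 0 0 0
    have h1 := eq (t, x, 1) hp1 0 0 0 0
    have a0 := alg (t, x, 0) hp0
    have a1 := alg (t, x, 1) hp1
    have c1 := eq_of_pv_eq_zero (contDiffOn_tau V) hτv ht x 1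
    have c2 := eq_of_pv_eq_zero hξ hξv ht x 1
    have c3 := eq_of_pv_eq_zero (contDiffOn_px hξ) hξxv ht x 1
    have c4 := eq_of_pv_eq_zero
      (contDiffOn_pt (contDiffOn_px hη)) hηtx ht x 1
    have c5 : eta V (t, x, 1) = eta V (t, x, 0) + pv (eta V) (t, x, 0) * 1 :=
      eq_add_mul_of_deriv_eq_const (g := fun v => eta V (t, x, v)) (fun v => by
        rw [← eq_of_pv_eq_zero (contDiffOn_pv hη) hηv ht x v]
        exact hasDerivAt_pv hη ht x v) 1
    rw [hηxxxx _ hp0, a0.1, a0.2.1] at h0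
    rw [hηxxxx _ hp1, a1.1, a1.2.1, c1, c2, c3, c4, c5, a0.2.1] at h1
    have e1 : β * px (xi V) (t, x, 0) = 0 := by linarith
    rw [eq_of_pv_eq_zero (contDiffOn_px hξ) hξxv ht x v]
    simpa [hβ] using e1
  have hr := eq p hp 0 0 0 0
  have a := alg p hp
  rw [hξx p hp] at a
  rw [hηxxxx p hp, hξx p hp, a.1, a.2.1] at hr
  exact ⟨by simpa using a.1, hτx p hp, hτv p hp, hξx p hp, hξv p hp, by simpa using a.2.1, a.2.2.1,
    by linarith⟩

theorem mem_pointSymmetries_iff_determining {α β : ℝ} (hα : α ≠ 0) (hβ : β ≠ 0)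
    {h : ℝ → ℝ → ℝ}
    (hh : ContDiffOn ℝ ∞ (fun p : ℝ × ℝ => h p.1 p.2) (Set.univ ×ˢ (I : Set ℝ)))
    {V : SmoothField I} :
    V ∈ pointSymmetries I α β h ↔ ∀ p ∈ strip I, Determining β h V p := by
  refine ⟨fun hV p hp => determining_of_mem hα hβ hh hV hp, fun hD j hj _ => ?_⟩
  have hξ := contDiffOn_xi V
  have hη := contDiffOn_eta V
  have zero : ∀ {f : Base → ℝ}, (∀ p ∈ strip I, f p = 0) → ∀ w, ∀ p ∈ strip I,
      partialD w f p = 0 := fun hf w p hp => partialD_eq_zero_of_eqOn_zero hf hp w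
  have hp : j.base ∈ strip I := hj
  have hξx : ∀ p ∈ strip I, px (xi V) p = 0 := fun p hp => (hD p hp).px_xi
  have hξxx := zero hξx (0, 1, 0)
  have hξxxx := zero hξxx (0, 1, 0)
  have hηv : ∀ p ∈ strip I, pv (eta V) p = 0 := fun p hp => (hD p hp).pv_eta
  have hηxx : ∀ p ∈ strip I, px (px (eta V)) p = 0 := fun p hp => by
    refine (partialD_congr (fun q hq => (hD q hq).px_eta) hp _).trans ?_
    exact (px_pt_comm hξ hp).trans (zero hξx _ p hp)
  have e1 : px^[2] (xi V) j.base = 0 := hξxx _ hp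
  have e2 : px^[3] (xi V) j.base = 0 := hξxxx _ hp
  have e3 : px^[4] (xi V) j.base = 0 := zero hξxxx _ _ hp
  have e4 : px^[2] (eta V) j.base = 0 := hηxx _ hp
  have e5 : px^[4] (eta V) j.base = 0 := zero (zero hηxx (0, 1, 0)) _ _ hp
  have e6 : pt (px (xi V)) j.base = 0 := zero hξx _ _ hp
  have e7 : pt (pv (eta V)) j.base = 0 := zero hηv _ _ hp
  have d := hD _ hp
  have hr := d.remainder
  rw [prolong_potentialEq_of_affine α β hh (fun p hp => (hD p hp).px_tau)
    (fun p hp => (hD p hp).pv_tau) (fun p hp => (hD p hp).pv_xi)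
    (fun p hp => (pv_px_comm hη hp).trans (zero hηv _ p hp)) (zero hηv _) hj rfl,
    e1, e2, e3, e4, e5, e6, e7, d.pt_tau, d.px_xi, d.pv_eta, d.px_eta]
  have hb : j.base.2.1 = j.2.1 ∧ j.base.1 = j.1 := ⟨rfl, rfl⟩
  rw [hb.1, hb.2] at hr
  linarith

/-! ### Functions of time -/

theorem differentiableAt_of_contDiffOn {f : ℝ → ℝ} (hf : ContDiffOn ℝ ∞ f I) {t : ℝ} (ht : t ∈ I) :
    DifferentiableAt ℝ f t :=
  (hf.contDiffAt (I.isOpen.mem_nhds ht)).differentiableAt (by simp)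

theorem exists_antiderivative (hI : IsConnected (I : Set ℝ)) {f : ℝ → ℝ}
    (hf : ContDiffOn ℝ ∞ f I) : ∃ F : ℝ → ℝ, ∀ t ∈ I, HasDerivAt F (f t) t := by
  obtain ⟨t₀, h₀⟩ := hI.nonempty
  have hc : ContinuousOn f I := hf.continuousOn
  refine ⟨fun t => ∫ s in t₀..t, f s, fun t ht => ?_⟩
  refine intervalIntegral.integral_hasDerivAt_right ?_ ?_ (hc.continuousAt (I.isOpen.mem_nhds ht))
  · exact (hc.mono (hI.isPreconnected.ordConnected.uIcc_subset h₀ ht)).intervalIntegrable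
  · exact hc.stronglyMeasurableAtFilter I.isOpen t ht

theorem eq_of_hasDerivAt_zero (hI : IsConnected (I : Set ℝ)) {f : ℝ → ℝ}
    (hf : ∀ t ∈ I, HasDerivAt f 0 t) {s t : ℝ} (hs : s ∈ I) (ht : t ∈ I) : f s = f t :=
  I.isOpen.is_const_of_deriv_eq_zero hI.isPreconnected
    (fun t ht => (hf t ht).differentiableAt.differentiableWithinAt)
    (fun t ht => (hf t ht).deriv) hs ht

/-- A solution of `c' = m c` that vanishes at one time vanishes at all times. -/
theorem eq_zero_of_linear_ode (hI : IsConnected (I : Set ℝ)) {c m : ℝ → ℝ}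
    (hm : ContDiffOn ℝ ∞ m I) (hc : ∀ t ∈ I, HasDerivAt c (m t * c t) t) {t₀ : ℝ} (h₀ : t₀ ∈ I)
    (hz : c t₀ = 0) {t : ℝ} (ht : t ∈ I) : c t = 0 := by
  obtain ⟨M, hM⟩ := exists_antiderivative hI hm
  have key : c t * Real.exp (-M t) = c t₀ * Real.exp (-M t₀) :=
    eq_of_hasDerivAt_zero hI (f := fun t => c t * Real.exp (-M t))
      (fun t ht => by
        refine ((hc t ht).mul (hM t ht).neg.exp).congr_deriv ?_
        ring) ht h₀
  rw [hz, zero_mul] at key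
  exact (mul_eq_zero.1 key).resolve_right (Real.exp_ne_zero _)

/-! ### The general form of the symmetries -/

theorem partialD_comp_fst (w : Base) (k : ℝ → ℝ) (hw : w.1 = 0) (p : Base) :
    partialD w (fun p => k p.1) p = 0 := by
  simp [partialD, lineDeriv, hw]

theorem pt_comp_fst (k : ℝ → ℝ) (p : Base) : pt (fun p => k p.1) p = deriv k p.1 := by
  have := deriv_comp_const_add (f := k) p.1 0
  simpa [pt, partialD, lineDeriv] using this

/-- The field `V` is `T ∂_t + c(t) ∂_x + (c'(t) x + g(t)) ∂_v`, and the forcing satisfies the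
remaining condition `c'' - β (c' x + g) - c h_x - T h_t = 0`. -/
structure HasForm (β : ℝ) (h : ℝ → ℝ → ℝ) (V : SmoothField I) (T : ℝ) (c g : ℝ → ℝ) : Prop where
  contDiffOn_c : ContDiffOn ℝ ∞ c I
  contDiffOn_g : ContDiffOn ℝ ∞ g I
  apply_eq : ∀ p ∈ strip I, V.1 p = (T, c p.1, deriv c p.1 * p.2.1 + g p.1)
  remainder : ∀ x : ℝ, ∀ t ∈ I, deriv (deriv c) t - β * (deriv c t * x + g t)
    - (c t * forcingX h x t + T * forcingT h x t) = 0

theorem contDiffOn_time_line {f : Base → ℝ} (hf : ContDiffOn ℝ ∞ f (strip I)) :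
    ContDiffOn ℝ ∞ (fun t => f (t, 0, 0)) I :=
  hf.comp (f := fun t : ℝ => ((t, 0, 0) : Base)) (by fun_prop) fun _ ht => ht

theorem exists_hasForm {β : ℝ} {h : ℝ → ℝ → ℝ} (hI : IsConnected (I : Set ℝ)) {V : SmoothField I}
    (hV : ∀ p ∈ strip I, Determining β h V p) : ∃ T c g, HasForm β h V T c g := by
  obtain ⟨t₀, h₀⟩ := hI.nonempty
  have hτ := contDiffOn_tau V
  have hξ := contDiffOn_xi V
  have hη := contDiffOn_eta V
  have onAxis : ∀ {f : Base → ℝ}, ContDiffOn ℝ ∞ f (strip I) → (∀ p ∈ strip I, px f p = 0) →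
      (∀ p ∈ strip I, pv f p = 0) → ∀ p ∈ strip I, f p = f (p.1, 0, 0) := by
    rintro f hf hx hv ⟨t, x, v⟩ hp
    rw [eq_of_pv_eq_zero hf hv hp, eq_of_px_eq_zero hf hx hp]
  have eτ : ∀ p ∈ strip I, tau V p = tau V (t₀, 0, 0) := fun p hp => by
    rw [onAxis hτ (fun p hp => (hV p hp).px_tau) (fun p hp => (hV p hp).pv_tau) p hp]
    exact eq_of_hasDerivAt_zero hI (f := fun t => tau V (t, 0, 0))
      (fun t ht => (hasDerivAt_pt hτ ht 0 0).congr_deriv (hV (t, 0, 0) ht).pt_tau) hp h₀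
  have eξ := onAxis hξ (fun p hp => (hV p hp).px_xi) fun p hp => (hV p hp).pv_xi
  have eξt : ∀ p ∈ strip I, pt (xi V) p = deriv (fun t => xi V (t, 0, 0)) p.1 := fun p hp =>
    (partialD_congr eξ hp _).trans (pt_comp_fst (fun t => xi V (t, 0, 0)) p)
  have eηtx : ∀ p ∈ strip I,
      pt (px (eta V)) p = deriv (deriv fun t => xi V (t, 0, 0)) p.1 := fun p hp =>
    (partialD_congr (fun q hq => (hV q hq).px_eta.trans (eξt q hq)) hp _).trans
      (pt_comp_fst (deriv fun t => xi V (t, 0, 0)) p)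
  have eη : ∀ p ∈ strip I, eta V p
      = deriv (fun t => xi V (t, 0, 0)) p.1 * p.2.1 + eta V (p.1, 0, 0) := by
    rintro ⟨t, x, v⟩ hp
    rw [eq_of_pv_eq_zero hη (fun p hp => (hV p hp).pv_eta) hp]
    have := eq_add_mul_of_deriv_eq_const (g := fun x => eta V (t, x, 0))
      (m := deriv (fun t => xi V (t, 0, 0)) t) (fun x => by
        rw [← eξt (t, x, 0) hp, ← (hV (t, x, 0) hp).px_eta]
        exact hasDerivAt_px hη hp x 0) x
    linarith
  refine ⟨tau V (t₀, 0, 0), fun t => xi V (t, 0, 0), fun t => eta V (t, 0, 0),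
    contDiffOn_time_line hξ, contDiffOn_time_line hη, fun p hp => ?_, fun x t ht => ?_⟩
  · rw [← eτ p hp, ← eξ p hp, ← eη p hp]
    rfl
  · have hp : (t, x, 0) ∈ strip I := ht
    have := (hV (t, x, 0) hp).remainder
    rwa [eηtx _ hp, eτ _ hp, eξ _ hp, eη _ hp] at this

theorem HasForm.determining {β : ℝ} {h : ℝ → ℝ → ℝ} {V : SmoothField I} {T : ℝ} {c g : ℝ → ℝ}
    (hV : HasForm β h V T c g) {p : Base} (hp : p ∈ strip I) : Determining β h V p := by
  have eτ : ∀ p ∈ strip I, tau V p = T := fun p hp => by rw [tau, hV.apply_eq p hp]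
  have eξ : ∀ p ∈ strip I, xi V p = c p.1 := fun p hp => by rw [xi, hV.apply_eq p hp]
  have eη : ∀ p ∈ strip I, eta V p = deriv c p.1 * p.2.1 + g p.1 := fun p hp => by
    rw [eta, hV.apply_eq p hp]
  have zτ : ∀ w, partialD w (tau V) p = 0 := fun w =>
    (partialD_congr eτ hp w).trans (partialD_const w p T)
  have eηx : ∀ p ∈ strip I, px (eta V) p = deriv c p.1 := fun p hp => by
    refine (partialD_congr eη hp _).trans ?_
    have : HasDerivAt (fun s : ℝ => deriv c p.1 * (p.2.1 + s) + g p.1) (deriv c p.1) 0 := by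
      simpa using (((hasDerivAt_id (0 : ℝ)).const_add p.2.1).const_mul (deriv c p.1)).add_const
        (g p.1)
    simp [partialD, lineDeriv]
  have eξt : pt (xi V) p = deriv c p.1 := (partialD_congr eξ hp _).trans (pt_comp_fst c p)
  refine ⟨zτ _, zτ _, zτ _, (partialD_congr eξ hp _).trans (partialD_comp_fst _ c rfl p),
    (partialD_congr eξ hp _).trans (partialD_comp_fst _ c rfl p), ?_, (eηx p hp).trans eξt.symm, ?_⟩
  · refine (partialD_congr eη hp _).trans ?_
    simp [partialD, lineDeriv]
  · rw [show pt (px (eta V)) p = deriv (deriv c) p.1 from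
      (partialD_congr eηx hp _).trans (pt_comp_fst (deriv c) p), eτ p hp, eξ p hp, eη p hp]
    exact hV.remainder _ _ hp

theorem mem_pointSymmetries_iff {α β : ℝ} (hα : α ≠ 0) (hβ : β ≠ 0)
    (hI : IsConnected (I : Set ℝ)) {h : ℝ → ℝ → ℝ}
    (hh : ContDiffOn ℝ ∞ (fun p : ℝ × ℝ => h p.1 p.2) (Set.univ ×ˢ (I : Set ℝ)))
    {V : SmoothField I} : V ∈ pointSymmetries I α β h ↔ ∃ T c g, HasForm β h V T c g := by
  rw [mem_pointSymmetries_iff_determining hα hβ hh]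
  exact ⟨exists_hasForm hI, fun ⟨T, c, g, hV⟩ p hp => hV.determining hp⟩

theorem deriv_add_const_mul {c k : ℝ → ℝ} (hc : ContDiffOn ℝ ∞ c I) (hk : ContDiffOn ℝ ∞ k I)
    (r : ℝ) {t : ℝ} (ht : t ∈ I) :
    deriv (fun t => c t + r * k t) t = deriv c t + r * deriv k t :=
  ((differentiableAt_of_contDiffOn hc ht).hasDerivAt.add
    ((differentiableAt_of_contDiffOn hk ht).hasDerivAt.const_mul r)).deriv

theorem HasForm.add_smul {β : ℝ} {h : ℝ → ℝ → ℝ} {V W : SmoothField I} {T S : ℝ}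
    {c g k l : ℝ → ℝ} (hV : HasForm β h V T c g) (hW : HasForm β h W S k l) (r : ℝ) :
    HasForm β h (V + r • W) (T + r * S) (fun t => c t + r * k t) (fun t => g t + r * l t) := by
  have hd : Set.EqOn (deriv fun t => c t + r * k t) (fun t => deriv c t + r * deriv k t) I :=
    fun t ht => deriv_add_const_mul hV.contDiffOn_c hW.contDiffOn_c r ht
  refine ⟨hV.contDiffOn_c.add (contDiffOn_const.mul hW.contDiffOn_c),
    hV.contDiffOn_g.add (contDiffOn_const.mul hW.contDiffOn_g), fun p hp => ?_, fun x t ht => ?_⟩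
  · have : (V + r • W).1 p = V.1 p + r • W.1 p := rfl
    rw [this, hV.apply_eq p hp, hW.apply_eq p hp, hd hp]
    simp only [Prod.smul_mk, Prod.mk_add_mk, smul_eq_mul]
    congr 2
    ring_nf
  · rw [hd.deriv I.isOpen ht, hd ht,
      deriv_add_const_mul (contDiffOn_deriv hV.contDiffOn_c) (contDiffOn_deriv hW.contDiffOn_c) r
        ht]
    have h1 := hV.remainder x t ht
    have h2 := hW.remainder x t ht
    linear_combination h1 + r * h2

theorem hasForm_zero (β : ℝ) (h : ℝ → ℝ → ℝ) :
    HasForm β h (0 : SmoothField I) 0 (fun _ => 0) (fun _ => 0) :=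
  ⟨contDiffOn_const, contDiffOn_const, fun p _ => by
    have : (0 : SmoothField I).1 p = 0 := rfl
    rw [this]; simp; rfl, fun x t _ => by
    have : deriv (deriv fun _ : ℝ => (0 : ℝ)) t = 0 := by simp
    rw [this]; simp⟩

/-! ### The generators are symmetries -/

theorem SmoothField.of_apply (V : Base → Base) (hV : ContDiffOn ℝ ∞ V (strip I)) {p : Base}
    (hp : p ∈ strip I) : (SmoothField.of I V hV).1 p = V p :=
  Set.indicator_of_mem hp V

theorem BoostData.generator_apply (d : BoostData I) (β : ℝ) {p : Base} (hp : p ∈ strip I) :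
    (d.generator β).1 p = (1, d.c p.1, deriv d.c p.1 * (p.2.1 - d.intc p.1)
      + 1 / β * deriv (deriv d.c) p.1 - 1 / β * deriv d.h₀ p.1) :=
  SmoothField.of_apply _ _ hp

theorem BoostData.hasForm {β : ℝ} (hβ : β ≠ 0) {h : ℝ → ℝ → ℝ} (d : BoostData I)
    (hd : d.IsForcing β h) : HasForm β h (d.generator β) 1 d.c (fun t =>
      -(deriv d.c t * d.intc t) + 1 / β * deriv (deriv d.c) t - 1 / β * deriv d.h₀ t) := by
  have hc := d.contDiffOn_c
  have hC := contDiffOn_antideriv hc d.hasDerivAt_intc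
  refine ⟨hc, (((contDiffOn_deriv hc).mul hC).neg.add
    (contDiffOn_const.mul (contDiffOn_deriv (contDiffOn_deriv hc)))).sub
    (contDiffOn_const.mul (contDiffOn_deriv d.contDiffOn_h₀)), fun p hp => ?_, fun x t ht => ?_⟩
  · rw [d.generator_apply β hp]
    congr 2
    ring
  · have h1 := (d.contDiff_h₁.differentiable (by simp) (x - d.intc t)).hasDerivAt
    have hX : forcingX h x t = deriv d.h₁ (x - d.intc t) - β * d.c t := by
      have e : (fun y => h y t) = fun y =>
          d.h₁ (y - d.intc t) - β * d.c t * (y - d.intc t) + d.h₀ t := funext fun y => hd y t ht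
      have hs : HasDerivAt (fun y => y - d.intc t) 1 x := (hasDerivAt_id x).sub_const _
      rw [forcingX, e]
      refine (((h1.comp x hs).sub (hs.const_mul (β * d.c t))).add_const (d.h₀ t)).deriv.trans ?_
      ring
    have hT : forcingT h x t = -d.c t * deriv d.h₁ (x - d.intc t)
        - β * (deriv d.c t * (x - d.intc t) - d.c t * d.c t) + deriv d.h₀ t := by
      have e : Set.EqOn (fun s => h x s) (fun s =>
          d.h₁ (x - d.intc s) - β * d.c s * (x - d.intc s) + d.h₀ s) I := fun s hs => hd x s hs
      have hs : HasDerivAt (fun s => x - d.intc s) (-d.c t) t :=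
        (d.hasDerivAt_intc t ht).const_sub x
      have hc' := (differentiableAt_of_contDiffOn hc ht).hasDerivAt
      have h0' := (differentiableAt_of_contDiffOn d.contDiffOn_h₀ ht).hasDerivAt
      rw [forcingT, e.deriv I.isOpen ht]
      refine (((h1.comp t hs).sub ((hc'.const_mul β).mul hs)).add h0').deriv.trans ?_
      ring
    rw [hX, hT]
    field_simp
    ring

theorem FrameData.forcingX_eq {h : ℝ → ℝ → ℝ} (d : FrameData I) (hd : d.IsForcing h) (x : ℝ)
    {t : ℝ} (ht : t ∈ I) : forcingX h x t = 2 * d.h₂ t * x + d.h₁ t := by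
  have e : (fun y => h y t) = fun y => d.h₂ t * y ^ 2 + d.h₁ t * y + d.h₀ t :=
    funext fun y => hd y t ht
  rw [forcingX, e]
  refine (((((hasDerivAt_id x).pow 2).const_mul (d.h₂ t)).add
    ((hasDerivAt_id x).const_mul (d.h₁ t))).add_const (d.h₀ t)).deriv.trans ?_
  simp
  ring

/-- The `∂_x` component `exp (-(2/β) ∫ h₂ dt)` of the second generator. -/
def FrameData.scale (d : FrameData I) (β : ℝ) (t : ℝ) : ℝ := Real.exp (-(2 / β) * d.inth₂ t)

theorem FrameData.generator_apply (d : FrameData I) (β : ℝ) {p : Base} (hp : p ∈ strip I) :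
    (d.generator β).1 p = (0, d.scale β p.1, d.scale β p.1 * (4 / β ^ 3 * d.h₂ p.1 ^ 2
      - 2 / β ^ 2 * deriv d.h₂ p.1 - 1 / β * d.h₁ p.1 - 2 / β * d.h₂ p.1 * p.2.1)) :=
  SmoothField.of_apply _ _ hp

theorem FrameData.hasDerivAt_scale (d : FrameData I) (β : ℝ) {t : ℝ} (ht : t ∈ I) :
    HasDerivAt (d.scale β) (-(2 / β) * (d.h₂ t * d.scale β t)) t := by
  refine ((d.hasDerivAt_inth₂ t ht).const_mul (-(2 / β))).exp.congr_deriv ?_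
  rw [scale]
  ring

theorem FrameData.contDiffOn_scale (d : FrameData I) (β : ℝ) : ContDiffOn ℝ ∞ (d.scale β) I :=
  (contDiffOn_const.mul (contDiffOn_antideriv d.contDiffOn_h₂ d.hasDerivAt_inth₂)).exp

theorem FrameData.hasForm {β : ℝ} (hβ : β ≠ 0) {h : ℝ → ℝ → ℝ} (d : FrameData I)
    (hd : d.IsForcing h) : HasForm β h (d.generator β) 0 (d.scale β) (fun t => d.scale β t *
      (4 / β ^ 3 * d.h₂ t ^ 2 - 2 / β ^ 2 * deriv d.h₂ t - 1 / β * d.h₁ t)) := by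
  have h2 := d.contDiffOn_h₂
  have hE := d.contDiffOn_scale β
  have hE' : Set.EqOn (deriv (d.scale β)) (fun t => -(2 / β) * (d.h₂ t * d.scale β t)) I :=
    fun t ht => (d.hasDerivAt_scale β ht).deriv
  refine ⟨hE, hE.mul (((contDiffOn_const.mul (h2.pow 2)).sub
    (contDiffOn_const.mul (contDiffOn_deriv h2))).sub (contDiffOn_const.mul d.contDiffOn_h₁)),
    fun p hp => ?_, fun x t ht => ?_⟩
  · rw [d.generator_apply β hp, hE' hp]
    congr 2
    ring
  · have h2' := (differentiableAt_of_contDiffOn h2 ht).hasDerivAt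
    have hE'' : deriv (deriv (d.scale β)) t = -(2 / β) * (deriv d.h₂ t * d.scale β t
        + d.h₂ t * (-(2 / β) * (d.h₂ t * d.scale β t))) := by
      rw [hE'.deriv I.isOpen ht]
      exact ((h2'.mul (d.hasDerivAt_scale β ht)).const_mul (-(2 / β))).deriv
    rw [hE'', hE' ht, d.forcingX_eq hd x ht]
    field_simp
    ring

/-! ### The forcings that admit a symmetry -/

theorem contDiffOn_forcing_curve {h : ℝ → ℝ → ℝ}
    (hh : ContDiffOn ℝ ∞ (fun p : ℝ × ℝ => h p.1 p.2) (Set.univ ×ˢ (I : Set ℝ))) {y : ℝ → ℝ}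
    (hy : ContDiffOn ℝ ∞ y I) : ContDiffOn ℝ ∞ (fun t => h (y t) t) I :=
  hh.comp (f := fun t => (y t, t)) (hy.prodMk contDiffOn_id) fun _ ht => ⟨trivial, ht⟩

theorem contDiffOn_forcingX {h : ℝ → ℝ → ℝ}
    (hh : ContDiffOn ℝ ∞ (fun p : ℝ × ℝ => h p.1 p.2) (Set.univ ×ˢ (I : Set ℝ))) (x : ℝ) :
    ContDiffOn ℝ ∞ (forcingX h x) I := by
  have h1 : ContDiffOn ℝ ∞ (fun p => fderiv ℝ (fun p : ℝ × ℝ => h p.1 p.2) p (1, 0))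
      (Set.univ ×ˢ (I : Set ℝ)) :=
    (hh.fderiv_of_isOpen (isOpen_univ.prod I.isOpen) (m := ∞) (by simp)).clm_apply contDiffOn_const
  refine (h1.comp (f := fun t => (x, t)) (contDiffOn_const.prodMk contDiffOn_id)
    fun _ ht => ⟨trivial, ht⟩).congr fun t ht => ?_
  exact ((hasFDerivAt_forcing hh x ht).comp_hasDerivAt x (f := fun r => (r, t))
    ((hasDerivAt_id _).prodMk (hasDerivAt_const _ _))).deriv

/-- A symmetry with `∂_t` component `1` brings the forcing into the first form: along the
characteristics `x = χ + ∫ c dt`, the difference `h(x, t) - h(∫ c dt, t) + β c χ` is constant. -/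
theorem HasForm.exists_boostData {β : ℝ} (hI : IsConnected (I : Set ℝ)) {h : ℝ → ℝ → ℝ}
    (hh : ContDiffOn ℝ ∞ (fun p : ℝ × ℝ => h p.1 p.2) (Set.univ ×ˢ (I : Set ℝ)))
    {V : SmoothField I} {c g : ℝ → ℝ} (hV : HasForm β h V 1 c g) :
    ∃ d : BoostData I, d.IsForcing β h := by
  obtain ⟨t₀, h₀⟩ := hI.nonempty
  have hc := hV.contDiffOn_c
  obtain ⟨C, hC⟩ := exists_antiderivative hI hc
  have hCs := contDiffOn_antideriv hc hC
  have along : ∀ χ : ℝ, ∀ t ∈ I, HasDerivAt (fun t => h (χ + C t) t)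
      (deriv (deriv c) t - β * (deriv c t * (χ + C t) + g t)) t := fun χ t ht => by
    refine (hasDerivAt_forcing_curve hh ((hC t ht).const_add χ) (hasDerivAt_id t)
      ht).congr_deriv ?_
    have := hV.remainder (χ + C t) t ht
    simp only [id]
    linarith
  have invariant : ∀ χ : ℝ, ∀ t ∈ I, h (χ + C t) t - h (0 + C t) t + β * c t * χ
      = h (χ + C t₀) t₀ - h (0 + C t₀) t₀ + β * c t₀ * χ := fun χ t ht => by
    refine eq_of_hasDerivAt_zero hI
      (f := fun t => h (χ + C t) t - h (0 + C t) t + β * c t * χ) (fun t ht => ?_) ht h₀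
    refine (((along χ t ht).sub (along 0 t ht)).add
      (((differentiableAt_of_contDiffOn hc ht).hasDerivAt.const_mul β).mul_const χ)).congr_deriv ?_
    ring
  have hslice : ContDiff ℝ ∞ fun y => h y t₀ := contDiffOn_univ.1
    (hh.comp (f := fun y => (y, t₀)) (contDiffOn_id.prodMk contDiffOn_const)
      fun _ _ => ⟨trivial, h₀⟩)
  refine ⟨⟨c, C, fun t => h (C t) t,
    fun χ => h (χ + C t₀) t₀ - h (0 + C t₀) t₀ + β * c t₀ * χ, hc, hC,
    contDiffOn_forcing_curve hh hCs, ?_⟩, fun x t ht => ?_⟩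
  · exact ((hslice.comp (contDiff_id.add contDiff_const)).sub contDiff_const).add
      (contDiff_const.mul contDiff_id)
  · have := invariant (x - C t) t ht
    simp only [sub_add_cancel, zero_add] at this ⊢
    rw [← this]
    ring

theorem HasForm.hasDerivAt_c {β : ℝ} (hβ : β ≠ 0) {h : ℝ → ℝ → ℝ} {V : SmoothField I}
    {c g : ℝ → ℝ} (hV : HasForm β h V 0 c g) {t : ℝ} (ht : t ∈ I) :
    HasDerivAt c (-(1 / β) * (forcingX h 1 t - forcingX h 0 t) * c t) t := by
  refine (differentiableAt_of_contDiffOn hV.contDiffOn_c ht).hasDerivAt.congr_deriv ?_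
  have h0 := hV.remainder 0 t ht
  have h1 := hV.remainder 1 t ht
  field_simp
  linarith

/-- A symmetry without `∂_t` component whose `∂_x` component has a zero vanishes. -/
theorem HasForm.eq_zero {β : ℝ} (hβ : β ≠ 0) (hI : IsConnected (I : Set ℝ)) {h : ℝ → ℝ → ℝ}
    (hh : ContDiffOn ℝ ∞ (fun p : ℝ × ℝ => h p.1 p.2) (Set.univ ×ˢ (I : Set ℝ)))
    {V : SmoothField I} {c g : ℝ → ℝ} (hV : HasForm β h V 0 c g) {t₀ : ℝ} (h₀ : t₀ ∈ I)
    (hz : c t₀ = 0) : V = 0 := by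
  have hc : Set.EqOn c (fun _ => 0) I := fun t ht =>
    eq_zero_of_linear_ode hI
      (contDiffOn_const.mul ((contDiffOn_forcingX hh 1).sub (contDiffOn_forcingX hh 0)))
      (fun t ht => hV.hasDerivAt_c hβ ht) h₀ hz ht
  have hc' : Set.EqOn (deriv c) (fun _ => 0) I := fun t ht => by
    rw [hc.deriv I.isOpen ht]; simp
  have hc'' : Set.EqOn (deriv (deriv c)) (fun _ => 0) I := fun t ht => by
    rw [hc'.deriv I.isOpen ht]; simp
  have hg : ∀ t ∈ I, g t = 0 := fun t ht => by
    have := hV.remainder 0 t ht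
    rw [hc ht, hc' ht, hc'' ht] at this
    simpa [hβ] using this
  refine SmoothField.ext_strip fun p hp => ?_
  rw [hV.apply_eq p hp, hc hp, hc' hp, hg _ hp]
  simp

/-- A non-zero symmetry without `∂_t` component forces `h` to be quadratic in `x`. -/
theorem HasForm.exists_frameData {β : ℝ} (hβ : β ≠ 0) (hI : IsConnected (I : Set ℝ))
    {h : ℝ → ℝ → ℝ}
    (hh : ContDiffOn ℝ ∞ (fun p : ℝ × ℝ => h p.1 p.2) (Set.univ ×ˢ (I : Set ℝ)))
    {V : SmoothField I} {c g : ℝ → ℝ} (hV : HasForm β h V 0 c g) (hne : V ≠ 0) :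
    ∃ d : FrameData I, d.IsForcing h := by
  have hc : ∀ t ∈ I, c t ≠ 0 := fun t ht hz => hne (hV.eq_zero hβ hI hh ht hz)
  have hx0 := contDiffOn_forcingX hh 0
  have hx1 := contDiffOn_forcingX hh 1
  have h2 : ContDiffOn ℝ ∞ (fun t => (forcingX h 1 t - forcingX h 0 t) / 2) I :=
    (hx1.sub hx0).div_const 2
  obtain ⟨M, hM⟩ := exists_antiderivative hI h2
  refine ⟨⟨_, M, forcingX h 0, fun t => h 0 t, h2, hM, hx0,
    contDiffOn_forcing_curve hh contDiffOn_const⟩, fun x t ht => ?_⟩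
  have affine : ∀ x, forcingX h x t
      = forcingX h 0 t + (forcingX h 1 t - forcingX h 0 t) * x := fun x => by
    have e0 := hV.remainder 0 t ht
    have e1 := hV.remainder 1 t ht
    have e := hV.remainder x t ht
    have : c t * (forcingX h x t
        - (forcingX h 0 t + (forcingX h 1 t - forcingX h 0 t) * x)) = 0 := by
      linear_combination (1 - x) * e0 + x * e1 - e
    linarith [(mul_eq_zero.1 this).resolve_left (hc t ht)]
  have hd : ∀ x, HasDerivAt (fun x => h x t - (forcingX h 1 t - forcingX h 0 t) / 2 * x ^ 2)
      (forcingX h 0 t) x := fun x => by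
    have e : HasDerivAt (fun y => h y t) (forcingX h x t) x := by
      simpa using hasDerivAt_forcing_curve hh (hasDerivAt_id x) (hasDerivAt_const x t) ht
    refine (e.sub (((hasDerivAt_id x).pow 2).const_mul
      ((forcingX h 1 t - forcingX h 0 t) / 2))).congr_deriv ?_
    rw [affine x]
    simp
    ring
  have := eq_add_mul_of_deriv_eq_const hd x
  simp only at this ⊢
  linarith

/-! ### The space of symmetries -/

theorem exists_submodule_pointSymmetries {α β : ℝ} (hα : α ≠ 0) (hβ : β ≠ 0)
    (hI : IsConnected (I : Set ℝ)) {h : ℝ → ℝ → ℝ}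
    (hh : ContDiffOn ℝ ∞ (fun p : ℝ × ℝ => h p.1 p.2) (Set.univ ×ˢ (I : Set ℝ))) :
    ∃ S : Submodule ℝ (SmoothField I), (S : Set (SmoothField I)) = pointSymmetries I α β h := by
  have mem := fun V => mem_pointSymmetries_iff hα hβ hI hh (V := V)
  have comb : ∀ {V W : SmoothField I} (r : ℝ), V ∈ pointSymmetries I α β h →
      W ∈ pointSymmetries I α β h → V + r • W ∈ pointSymmetries I α β h := by
    intro V W r hV hW
    obtain ⟨T, c, g, hV⟩ := (mem V).1 hV
    obtain ⟨S, k, l, hW⟩ := (mem W).1 hW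
    exact (mem _).2 ⟨_, _, _, hV.add_smul hW r⟩
  have zero : (0 : SmoothField I) ∈ pointSymmetries I α β h :=
    (mem 0).2 ⟨_, _, _, hasForm_zero β h⟩
  exact ⟨⟨⟨⟨pointSymmetries I α β h, fun {V W} hV hW => by simpa using comb 1 hV hW⟩, zero⟩,
    fun r V hV => by simpa using comb r zero hV⟩, rfl⟩

/-- Without a second form, a symmetry is determined by its `∂_t` component. -/
theorem HasForm.eq_smul_boost {β : ℝ} (hβ : β ≠ 0) (hI : IsConnected (I : Set ℝ)) {h : ℝ → ℝ → ℝ}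
    (hh : ContDiffOn ℝ ∞ (fun p : ℝ × ℝ => h p.1 p.2) (Set.univ ×ˢ (I : Set ℝ)))
    {V : SmoothField I} {T : ℝ} {c g : ℝ → ℝ} (hV : HasForm β h V T c g) {d : BoostData I}
    (hd : d.IsForcing β h) (hF : ¬∃ d' : FrameData I, d'.IsForcing h) :
    V = T • d.generator β := by
  have h1 := hV.add_smul (d.hasForm hβ hd) (-T)
  rw [mul_one, add_neg_cancel, neg_smul, ← sub_eq_add_neg] at h1
  by_contra hne
  exact hF (h1.exists_frameData hβ hI hh (sub_ne_zero.2 hne))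

/-- A symmetry without `∂_t` component is a multiple of the second generator, as both solve the same
first-order linear equation. -/
theorem HasForm.exists_eq_smul_frame {β : ℝ} (hβ : β ≠ 0) (hI : IsConnected (I : Set ℝ))
    {h : ℝ → ℝ → ℝ}
    (hh : ContDiffOn ℝ ∞ (fun p : ℝ × ℝ => h p.1 p.2) (Set.univ ×ˢ (I : Set ℝ)))
    {V : SmoothField I} {c g : ℝ → ℝ} (hV : HasForm β h V 0 c g) {d : FrameData I}
    (hd : d.IsForcing h) : ∃ r : ℝ, V = r • d.generator β := by
  obtain ⟨t₀, h₀⟩ := hI.nonempty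
  have hE : d.scale β t₀ ≠ 0 := Real.exp_ne_zero _
  have h1 := hV.add_smul (d.hasForm hβ hd) (-(c t₀ / d.scale β t₀))
  rw [mul_zero, add_zero] at h1
  refine ⟨c t₀ / d.scale β t₀, ?_⟩
  have := h1.eq_zero hβ hI hh h₀ (by field_simp; ring)
  rwa [neg_smul, ← sub_eq_add_neg, sub_eq_zero] at this

/-- Without a first form, all symmetries have zero `∂_t` component. -/
theorem HasForm.time_eq_zero {β : ℝ} (hI : IsConnected (I : Set ℝ)) {h : ℝ → ℝ → ℝ}
    (hh : ContDiffOn ℝ ∞ (fun p : ℝ × ℝ => h p.1 p.2) (Set.univ ×ˢ (I : Set ℝ)))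
    {V : SmoothField I} {T : ℝ} {c g : ℝ → ℝ} (hV : HasForm β h V T c g)
    (hB : ¬∃ d : BoostData I, d.IsForcing β h) : T = 0 := by
  by_contra hT
  have h1 := (hasForm_zero β h).add_smul hV T⁻¹
  rw [inv_mul_cancel₀ hT, zero_add (1 : ℝ)] at h1
  exact hB (h1.exists_boostData hI hh)

/-! ### Forcings that have both forms -/

theorem BoostData.slope_eq {β k : ℝ} {h : ℝ → ℝ → ℝ} {l₁ l₀ : ℝ → ℝ}
    (hq : ∀ x : ℝ, ∀ t ∈ I, h x t = k * x ^ 2 + l₁ t * x + l₀ t) (d : BoostData I)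
    (hd : d.IsForcing β h) {t : ℝ} (ht : t ∈ I) :
    l₁ t = (d.h₁ 1 - d.h₁ (-1)) / 2 - β * d.c t - 2 * k * d.intc t := by
  have e1 := hd (d.intc t + 1) t ht
  have e2 := hd (d.intc t + -1) t ht
  rw [hq _ t ht, add_sub_cancel_left] at e1 e2
  linear_combination (e1 - e2) / 2

theorem FrameData.isForcing_iff {k : ℝ} {h : ℝ → ℝ → ℝ} {l₁ l₀ : ℝ → ℝ}
    (hq : ∀ x : ℝ, ∀ t ∈ I, h x t = k * x ^ 2 + l₁ t * x + l₀ t) (d : FrameData I) :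
    d.IsForcing h ↔ ∀ t ∈ I, d.h₂ t = k ∧ d.h₁ t = l₁ t ∧ d.h₀ t = l₀ t := by
  refine ⟨fun hd t ht => ?_, fun hd x t ht => ?_⟩
  · have e0 := hd 0 t ht
    have e1 := hd 1 t ht
    have e2 := hd (-1) t ht
    rw [hq _ t ht] at e0 e1 e2
    refine ⟨by linarith, by linarith, by linarith⟩
  · obtain ⟨e2, e1, e0⟩ := hd t ht
    rw [e2, e1, e0, hq x t ht]

theorem exists_frameData_of_quadratic {k : ℝ} {h : ℝ → ℝ → ℝ} {l₁ l₀ : ℝ → ℝ}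
    (h₁ : ContDiffOn ℝ ∞ l₁ I) (h₀ : ContDiffOn ℝ ∞ l₀ I)
    (hq : ∀ x : ℝ, ∀ t ∈ I, h x t = k * x ^ 2 + l₁ t * x + l₀ t) :
    ∃ d : FrameData I, d.IsForcing h :=
  ⟨⟨fun _ => k, fun t => t * k, l₁, l₀, contDiffOn_const,
    fun t _ => by simpa using (hasDerivAt_id t).mul_const k, h₁, h₀⟩, hq⟩

/-- For quadratic `h₁` the first form amounts to two equations for the coefficients. -/
theorem BoostData.isForcing_iff_coeff {β k : ℝ} {h : ℝ → ℝ → ℝ} {l₁ l₀ : ℝ → ℝ}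
    (hq : ∀ x : ℝ, ∀ t ∈ I, h x t = k * x ^ 2 + l₁ t * x + l₀ t) (d : BoostData I)
    (hd : ∀ χ : ℝ, d.h₁ χ = k * χ ^ 2) :
    d.IsForcing β h ↔ ∀ t ∈ I, β * d.c t = -(2 * k * d.intc t) - l₁ t ∧
      d.h₀ t = l₀ t - k * d.intc t ^ 2 - β * d.c t * d.intc t := by
  refine ⟨fun hf t ht => ?_, fun hf x t ht => ?_⟩
  · have e0 := hf 0 t ht
    have e1 := hf 1 t ht
    rw [hq _ t ht, hd] at e0 e1
    constructor <;> linarith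
  · obtain ⟨e1, e0⟩ := hf t ht
    rw [hq x t ht, hd, e0]
    linear_combination x * e1

theorem hasDerivAt_integrating_factor {β k : ℝ} {l₁ Y : ℝ → ℝ} {t : ℝ}
    (hY : HasDerivAt Y (Real.exp (2 * k / β * t) * l₁ t) t) :
    HasDerivAt (fun s => 1 / β * Real.exp (-(2 * k / β) * s) * Y s)
      (1 / β * l₁ t - 2 * k / β * (1 / β * Real.exp (-(2 * k / β) * t) * Y t)) t := by
  have hE : HasDerivAt (fun s => Real.exp (-(2 * k / β) * s))
      (Real.exp (-(2 * k / β) * t) * (-(2 * k / β) * 1)) t :=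
    ((hasDerivAt_id t).const_mul _).exp
  refine ((hE.const_mul (1 / β)).mul hY).congr_deriv ?_
  have : Real.exp (-(2 * k / β) * t) * Real.exp (2 * k / β * t) = 1 := by
    rw [← Real.exp_add, neg_mul, neg_add_cancel, Real.exp_zero]
  linear_combination (1 / β * l₁ t) * this

/-- The functions `c`, `∫ c dt` and `h₀` in the first form with `h₁ = k χ²`, by solution of
`(∫ c dt)' = -(2 k / β) ∫ c dt - l₁ / β`. -/
theorem BoostData.isForcing_iff {β k : ℝ} (hβ : β ≠ 0) {h : ℝ → ℝ → ℝ} {l₁ l₀ : ℝ → ℝ}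
    (hq : ∀ x : ℝ, ∀ t ∈ I, h x t = k * x ^ 2 + l₁ t * x + l₀ t) (d : BoostData I)
    (hd : ∀ χ : ℝ, d.h₁ χ = k * χ ^ 2) :
    d.IsForcing β h ↔ ∃ Y : ℝ → ℝ,
      (∀ t ∈ I, HasDerivAt Y (Real.exp (2 * k / β * t) * l₁ t) t) ∧
      ∀ t ∈ I, d.intc t = -(1 / β * Real.exp (-(2 * k / β) * t) * Y t) ∧
        d.c t = -deriv (fun s => 1 / β * Real.exp (-(2 * k / β) * s) * Y s) t ∧
        d.h₀ t = l₀ t - k * d.intc t ^ 2 - β * d.c t * d.intc t := by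
  rw [d.isForcing_iff_coeff hq hd]
  constructor
  · intro hf
    have hY : ∀ t ∈ I, HasDerivAt (fun t => -β * Real.exp (2 * k / β * t) * d.intc t)
        (Real.exp (2 * k / β * t) * l₁ t) t := fun t ht => by
      have hE : HasDerivAt (fun s => Real.exp (2 * k / β * s))
          (Real.exp (2 * k / β * t) * (2 * k / β * 1)) t :=
        ((hasDerivAt_id t).const_mul _).exp
      refine ((hE.const_mul (-β)).mul (d.hasDerivAt_intc t ht)).congr_deriv ?_
      have e := (hf t ht).1
      have e2 : β * (2 * k / β) = 2 * k := by field_simp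
      linear_combination -Real.exp (2 * k / β * t) * e
        - Real.exp (2 * k / β * t) * d.intc t * e2
    refine ⟨_, hY, fun t ht => ?_⟩
    have e1 : d.intc t = -(1 / β * Real.exp (-(2 * k / β) * t)
        * (-β * Real.exp (2 * k / β * t) * d.intc t)) := by
      have : Real.exp (-(2 * k / β) * t) * Real.exp (2 * k / β * t) = 1 := by
        rw [← Real.exp_add, neg_mul, neg_add_cancel, Real.exp_zero]
      have e2 : 1 / β * β = 1 := by field_simp
      linear_combination (-1 / β * β) * d.intc t * this - d.intc t * e2
    refine ⟨e1, ?_, (hf t ht).2⟩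
    rw [(hasDerivAt_integrating_factor (hY t ht)).deriv]
    have e := (hf t ht).1
    have e3 : d.c t = 1 / β * (β * d.c t) := by field_simp
    rw [e3, e]
    linear_combination (-(2 * k / β)) * e1
  · rintro ⟨Y, hY, hf⟩ t ht
    obtain ⟨e1, e2, e3⟩ := hf t ht
    refine ⟨?_, e3⟩
    rw [(hasDerivAt_integrating_factor (hY t ht)).deriv] at e2
    rw [e2, e1]
    field_simp
    ring

theorem exists_boostData_of_quadratic {β k : ℝ} (hβ : β ≠ 0) (hI : IsConnected (I : Set ℝ))
    {h : ℝ → ℝ → ℝ} {l₁ l₀ : ℝ → ℝ} (h₁ : ContDiffOn ℝ ∞ l₁ I) (h₀ : ContDiffOn ℝ ∞ l₀ I)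
    (hq : ∀ x : ℝ, ∀ t ∈ I, h x t = k * x ^ 2 + l₁ t * x + l₀ t) :
    ∃ d : BoostData I, d.IsForcing β h ∧ ∀ χ : ℝ, d.h₁ χ = k * χ ^ 2 := by
  have hE : ∀ r : ℝ, ContDiffOn ℝ ∞ (fun t => Real.exp (r * t)) I := fun r =>
    (contDiff_const.mul contDiff_id).exp.contDiffOn
  have hf := (hE (2 * k / β)).mul h₁
  obtain ⟨Y, hY⟩ := exists_antiderivative hI hf
  have hYs := contDiffOn_antideriv hf hY
  let C : ℝ → ℝ := fun t => -(1 / β * Real.exp (-(2 * k / β) * t) * Y t)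
  let c : ℝ → ℝ := fun t => -deriv (fun s => 1 / β * Real.exp (-(2 * k / β) * s) * Y s) t
  have hC : ContDiffOn ℝ ∞ C I := ((contDiffOn_const.mul (hE _)).mul hYs).neg
  have hC' : ∀ t ∈ I, HasDerivAt C (c t) t := fun t ht =>
    (hasDerivAt_integrating_factor (hY t ht)).differentiableAt.hasDerivAt.neg
  have hc : ContDiffOn ℝ ∞ c I :=
    (contDiffOn_deriv hC).congr fun t ht => ((hC' t ht).deriv).symm
  let d : BoostData I := ⟨c, C, fun t => l₀ t - k * C t ^ 2 - β * c t * C t, fun χ => k * χ ^ 2,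
    hc, hC', (h₀.sub (contDiffOn_const.mul (hC.pow 2))).sub ((contDiffOn_const.mul hc).mul hC),
    contDiff_const.mul (contDiff_id.pow 2)⟩
  exact ⟨d, (d.isForcing_iff hβ hq fun _ => rfl).2 ⟨Y, hY, fun t _ => ⟨rfl, rfl, rfl⟩⟩,
    fun _ => rfl⟩

/-- The second difference of `h` in `χ` along `x = χ + ∫ c dt` is independent of `t` in the first
form and equal to `2 h₂` in the second. -/
theorem FrameData.h₂_eq_of_boostData {β : ℝ} {h : ℝ → ℝ → ℝ} {d : BoostData I} {d' : FrameData I}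
    (hd : d.IsForcing β h) (hd' : d'.IsForcing h) {t : ℝ} (ht : t ∈ I) :
    d'.h₂ t = (d.h₁ 1 + d.h₁ (-1) - 2 * d.h₁ 0) / 2 := by
  have e0 := hd (d.intc t + 0) t ht
  have e1 := hd (d.intc t + 1) t ht
  have e2 := hd (d.intc t + -1) t ht
  rw [hd' _ t ht, add_sub_cancel_left] at e0 e1 e2
  linear_combination (e1 + e2 - 2 * e0) / 2

/-! ### The commutator and the Lie algebra of symmetries -/

theorem HasForm.fderiv_apply {β : ℝ} {h : ℝ → ℝ → ℝ} {V : SmoothField I} {T : ℝ} {c g : ℝ → ℝ}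
    (hV : HasForm β h V T c g) {p : Base} (hp : p ∈ strip I) (w : Base) :
    fderiv ℝ V.1 p w = (0, w.1 * deriv c p.1,
      w.1 * (deriv (deriv c) p.1 * p.2.1 + deriv g p.1) + w.2.1 * deriv c p.1) := by
  have hl : ∀ a b : ℝ, HasDerivAt (fun s : ℝ => a + s * b) b 0 := fun a b => by
    simpa using ((hasDerivAt_id (0 : ℝ)).mul_const b).const_add a
  have curve : ∀ {f : ℝ → ℝ}, ContDiffOn ℝ ∞ f I →
      HasDerivAt (fun s => f (p.1 + s * w.1)) (deriv f p.1 * w.1) 0 := fun {f} hf => by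
    have hf' : HasDerivAt f (deriv f p.1) (p.1 + 0 * w.1) := by
      simpa using (differentiableAt_of_contDiffOn hf hp).hasDerivAt
    exact hf'.comp 0 (hl p.1 w.1)
  have hc := curve hV.contDiffOn_c
  have hc' := curve (contDiffOn_deriv hV.contDiffOn_c)
  have hg := curve hV.contDiffOn_g
  have key := (hasDerivAt_const (0 : ℝ) T).prodMk
    (hc.prodMk ((hc'.mul (hl p.2.1 w.2.1)).add hg))
  rw [← (differentiableAt_field V hp).lineDeriv_eq_fderiv, lineDeriv]
  have hev : (fun s : ℝ => V.1 (p + s • w)) =ᶠ[nhds 0] fun s => (T, c (p.1 + s * w.1),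
      deriv c (p.1 + s * w.1) * (p.2.1 + s * w.2.1) + g (p.1 + s * w.1)) := by
    have hcont : ContinuousAt (fun s : ℝ => p + s • w) 0 := by fun_prop
    have hm : strip I ∈ nhds (p + (0 : ℝ) • w) := (isOpen_strip I).mem_nhds (by simpa using hp)
    filter_upwards [hcont hm] with s hs
    exact hV.apply_eq _ hs
  rw [hev.deriv_eq]
  refine key.deriv.trans ?_
  simp only [zero_mul, add_zero]
  congr 2
  · ring
  · ring

theorem lie_generators {β k : ℝ} (hβ : β ≠ 0) {h : ℝ → ℝ → ℝ} {l₁ l₀ : ℝ → ℝ}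
    (hq : ∀ x : ℝ, ∀ t ∈ I, h x t = k * x ^ 2 + l₁ t * x + l₀ t) {d : BoostData I}
    {d' : FrameData I} (hd : d.IsForcing β h) (hd' : d'.IsForcing h) :
    ⁅d.generator β, d'.generator β⁆ = -(2 * k / β) • d'.generator β := by
  refine SmoothField.ext_strip fun p hp => ?_
  have hV := d.hasForm hβ hd
  have hW := d'.hasForm hβ hd'
  have co := (d'.isForcing_iff hq).1 hd'
  have hE : Set.EqOn (deriv (d'.scale β)) (fun t => -(2 * k / β) * d'.scale β t) I :=
    fun t ht => by
      rw [(d'.hasDerivAt_scale β ht).deriv, (co t ht).1]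
      ring
  have hEp : deriv (d'.scale β) p.1 = -(2 * k / β) * d'.scale β p.1 := hE hp
  have hE' : deriv (deriv (d'.scale β)) p.1 = -(2 * k / β) * (-(2 * k / β) * d'.scale β p.1) := by
    rw [hE.deriv I.isOpen hp, ← hEp]
    exact ((d'.hasDerivAt_scale β hp).differentiableAt.hasDerivAt.const_mul _).deriv
  have hl₁ : HasDerivAt l₁ (-(β * deriv d.c p.1) - 2 * k * d.c p.1) p.1 := by
    have e : Set.EqOn l₁ (fun t => (d.h₁ 1 - d.h₁ (-1)) / 2 - β * d.c t - 2 * k * d.intc t) I :=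
      fun t ht => d.slope_eq hq hd ht
    exact ((((differentiableAt_of_contDiffOn d.contDiffOn_c hp).hasDerivAt.const_mul β).const_sub
      _).sub ((d.hasDerivAt_intc p.1 hp).const_mul (2 * k))).congr_of_eventuallyEq
      (e.eventuallyEq_of_mem (I.isOpen.mem_nhds hp))
  have eg : Set.EqOn (fun t => d'.scale β t *
      (4 / β ^ 3 * d'.h₂ t ^ 2 - 2 / β ^ 2 * deriv d'.h₂ t - 1 / β * d'.h₁ t))
      (fun t => d'.scale β t * (4 / β ^ 3 * k ^ 2 - 1 / β * l₁ t)) I := fun t ht => by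
    have h2 : Set.EqOn d'.h₂ (fun _ => k) I := fun t ht => (co t ht).1
    simp only [h2.deriv I.isOpen ht, (co t ht).1, (co t ht).2.1, deriv_const]
    ring
  have egp : d'.scale β p.1 * (4 / β ^ 3 * d'.h₂ p.1 ^ 2 - 2 / β ^ 2 * deriv d'.h₂ p.1
      - 1 / β * d'.h₁ p.1) = d'.scale β p.1 * (4 / β ^ 3 * k ^ 2 - 1 / β * l₁ p.1) := eg hp
  have hg' := (eg.deriv I.isOpen hp).trans ((d'.hasDerivAt_scale β hp).mul
    ((hl₁.const_mul (1 / β)).const_sub (4 / β ^ 3 * k ^ 2))).deriv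
  have hs : (-(2 * k / β) • d'.generator β : SmoothField I).1 p
      = -(2 * k / β) • (d'.generator β).1 p := rfl
  rw [SmoothField.lie_apply _ _ hp, VectorField.lieBracket, hV.fderiv_apply hp,
    hW.fderiv_apply hp, hs, hV.apply_eq p hp, hW.apply_eq p hp, hg', hE', hEp, egp,
    (co _ hp).1]
  simp only [Prod.smul_mk, Prod.mk_sub_mk, smul_eq_mul, Prod.mk.injEq]
  refine ⟨by ring, by ring, ?_⟩
  field_simp
  ring

/-- The plane spanned by `X` and `Y` with `[X, Y] = r Y` is a solvable Lie algebra. -/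
theorem exists_solvable_lieSubalgebra {L : Type*} [LieRing L] [LieAlgebra ℝ L] {X Y : L} {r : ℝ}
    (hXY : ⁅X, Y⁆ = r • Y) (hli : LinearIndependent ℝ ![X, Y]) :
    ∃ S : LieSubalgebra ℝ L, (S : Set L) = (Submodule.span ℝ {X, Y} : Set L) ∧
      Module.finrank ℝ S = 2 ∧ LieAlgebra.IsSolvable S := by
  have bracket : ∀ {a b : L}, a ∈ Submodule.span ℝ {X, Y} → b ∈ Submodule.span ℝ {X, Y} →
      ⁅a, b⁆ ∈ Submodule.span ℝ {Y} := by
    intro a b ha hb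
    obtain ⟨p, q, rfl⟩ := Submodule.mem_span_pair.1 ha
    obtain ⟨p', q', rfl⟩ := Submodule.mem_span_pair.1 hb
    have hYX : ⁅Y, X⁆ = -(r • Y) := by rw [← lie_skew, hXY]
    refine Submodule.mem_span_singleton.2 ⟨(p * q' - q * p') * r, ?_⟩
    simp only [add_lie, lie_add, smul_lie, lie_smul, lie_self, hXY, hYX]
    module
  have sub : Submodule.span ℝ {Y} ≤ Submodule.span ℝ {X, Y} := Submodule.span_mono (by simp)
  let S : LieSubalgebra ℝ L :=
    { Submodule.span ℝ {X, Y} with lie_mem' := fun ha hb => sub (bracket ha hb) }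
  refine ⟨S, rfl, ?_, ?_⟩
  · have := finrank_span_eq_card hli
    rw [Matrix.range_cons, Matrix.range_cons, Matrix.range_empty, Set.union_empty] at this
    exact this
  · let J : LieIdeal ℝ S :=
      { (Submodule.span ℝ {Y}).comap S.toSubmodule.subtype with
        lie_mem := fun {a b} _ => bracket a.2 b.2 }
    have h1 : ⁅(⊤ : LieIdeal ℝ S), (⊤ : LieIdeal ℝ S)⁆ ≤ J :=
      (LieSubmodule.lie_le_iff _ _ _).2 fun a _ b _ => bracket a.2 b.2
    have h2 : ⁅J, J⁆ = ⊥ := by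
      rw [eq_bot_iff, LieSubmodule.lie_le_iff]
      rintro a ha b hb
      obtain ⟨p, hp⟩ := Submodule.mem_span_singleton.1 (show a.1 ∈ Submodule.span ℝ {Y} from ha)
      obtain ⟨q, hq⟩ := Submodule.mem_span_singleton.1 (show b.1 ∈ Submodule.span ℝ {Y} from hb)
      rw [LieSubmodule.mem_bot]
      apply Subtype.ext
      rw [LieSubalgebra.coe_bracket, ← hp, ← hq]
      simp
    refine LieAlgebra.IsSolvable.mk (R := ℝ) (k := 2) (le_bot_iff.1 ?_)
    exact (LieSubmodule.mono_lie h1 h1).trans h2.le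

theorem linearIndependent_generators (hI : IsConnected (I : Set ℝ)) (β : ℝ) (d : BoostData I)
    (d' : FrameData I) : LinearIndependent ℝ ![d.generator β, d'.generator β] := by
  obtain ⟨t₀, h₀⟩ := hI.nonempty
  have hp : ((t₀, 0, 0) : Base) ∈ strip I := h₀
  rw [LinearIndependent.pair_iff]
  intro r s hrs
  have e : r • (d.generator β).1 (t₀, 0, 0) + s • (d'.generator β).1 (t₀, 0, 0) = 0 :=
    congrFun (congrArg Subtype.val hrs) (t₀, 0, 0)
  rw [d.generator_apply β hp, d'.generator_apply β hp] at e
  have e1 : r * 1 + s * 0 = 0 := congrArg Prod.fst e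
  have e2 : r * d.c t₀ + s * d'.scale β t₀ = 0 := congrArg (fun q : Base => q.2.1) e
  have hr : r = 0 := by linarith
  have hE : d'.scale β t₀ ≠ 0 := Real.exp_ne_zero _
  refine ⟨hr, ?_⟩
  rw [hr, zero_mul, zero_add] at e2
  exact (mul_eq_zero.1 e2).resolve_right hE

end Ostrovsky

end

theorem theorem3p1 (α β : ℝ) (hα : α ≠ 0) (hβ : β ≠ 0)
    (I : TopologicalSpace.Opens ℝ) (hI : IsConnected (I : Set ℝ))
    (h : ℝ → ℝ → ℝ)
    (hh : ContDiffOn ℝ ∞ (fun p : ℝ × ℝ => h p.1 p.2) (Set.univ ×ˢ (I : Set ℝ))) :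
    -- the classification of the point symmetries
    ((∀ d : Ostrovsky.BoostData I, d.IsForcing β h →
        d.generator β ∈ Ostrovsky.pointSymmetries I α β h) ∧
      (∀ d : Ostrovsky.FrameData I, d.IsForcing h →
        d.generator β ∈ Ostrovsky.pointSymmetries I α β h) ∧
      ((¬ ∃ d : Ostrovsky.BoostData I, d.IsForcing β h) →
        (¬ ∃ d : Ostrovsky.FrameData I, d.IsForcing h) →
          Ostrovsky.pointSymmetries I α β h = {0}) ∧
      (∀ d : Ostrovsky.BoostData I, d.IsForcing β h →
        (¬ ∃ d' : Ostrovsky.FrameData I, d'.IsForcing h) →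
          Ostrovsky.pointSymmetries I α β h
            = (Submodule.span ℝ {d.generator β} : Set (Ostrovsky.SmoothField I))) ∧
      (∀ d' : Ostrovsky.FrameData I, d'.IsForcing h →
        (¬ ∃ d : Ostrovsky.BoostData I, d.IsForcing β h) →
          Ostrovsky.pointSymmetries I α β h
            = (Submodule.span ℝ {d'.generator β} : Set (Ostrovsky.SmoothField I))) ∧
      (∀ (d : Ostrovsky.BoostData I) (d' : Ostrovsky.FrameData I),
        d.IsForcing β h → d'.IsForcing h →
          Ostrovsky.pointSymmetries I α β h
            = (Submodule.span ℝ {d.generator β, d'.generator β} :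
                Set (Ostrovsky.SmoothField I)))) ∧
    -- both generators are admitted exactly for the quadratic forcings with constant `k`
    (((∃ d : Ostrovsky.BoostData I, d.IsForcing β h) ∧
        (∃ d' : Ostrovsky.FrameData I, d'.IsForcing h)) ↔
      ∃ (k : ℝ) (l₁ l₀ : ℝ → ℝ), ContDiffOn ℝ ∞ l₁ I ∧ ContDiffOn ℝ ∞ l₀ I ∧
        ∀ x : ℝ, ∀ t ∈ I, h x t = k * x ^ 2 + l₁ t * x + l₀ t) ∧
    -- the symmetry algebra, the commutator and the overlap formulas for these forcings
    (∀ (k : ℝ) (l₁ l₀ : ℝ → ℝ), ContDiffOn ℝ ∞ l₁ I → ContDiffOn ℝ ∞ l₀ I →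
      (∀ x : ℝ, ∀ t ∈ I, h x t = k * x ^ 2 + l₁ t * x + l₀ t) →
      (∃ L : LieSubalgebra ℝ (Ostrovsky.SmoothField I),
        (L : Set (Ostrovsky.SmoothField I)) = Ostrovsky.pointSymmetries I α β h ∧
        Module.finrank ℝ L = 2 ∧ LieAlgebra.IsSolvable L) ∧
      (∀ (d : Ostrovsky.BoostData I) (d' : Ostrovsky.FrameData I),
        d.IsForcing β h → d'.IsForcing h →
          ⁅d.generator β, d'.generator β⁆ = -(2 * k / β) • d'.generator β) ∧
      (∀ d' : Ostrovsky.FrameData I, d'.IsForcing h ↔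
        ∀ t ∈ I, d'.h₂ t = k ∧ d'.h₁ t = l₁ t ∧ d'.h₀ t = l₀ t) ∧
      (∃ d : Ostrovsky.BoostData I, d.IsForcing β h ∧ ∀ χ : ℝ, d.h₁ χ = k * χ ^ 2) ∧
      (∀ d : Ostrovsky.BoostData I, (∀ χ : ℝ, d.h₁ χ = k * χ ^ 2) →
        (d.IsForcing β h ↔
          ∃ Y : ℝ → ℝ,
            (∀ t ∈ I, HasDerivAt Y (Real.exp (2 * k / β * t) * l₁ t) t) ∧
            ∀ t ∈ I,
              d.intc t = -(1 / β * Real.exp (-(2 * k / β) * t) * Y t) ∧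
              d.c t
                = -deriv (fun s => 1 / β * Real.exp (-(2 * k / β) * s) * Y s) t ∧
              d.h₀ t = l₀ t - k * d.intc t ^ 2 - β * d.c t * d.intc t))) := by
  have mem := fun V => Ostrovsky.mem_pointSymmetries_iff hα hβ hI hh (V := V)
  obtain ⟨S, hS⟩ := Ostrovsky.exists_submodule_pointSymmetries hα hβ hI hh
  have boost : ∀ d : Ostrovsky.BoostData I, d.IsForcing β h →
      d.generator β ∈ Ostrovsky.pointSymmetries I α β h :=
    fun d hd => (mem _).2 ⟨_, _, _, d.hasForm hβ hd⟩
  have frame : ∀ d : Ostrovsky.FrameData I, d.IsForcing h →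
      d.generator β ∈ Ostrovsky.pointSymmetries I α β h :=
    fun d hd => (mem _).2 ⟨_, _, _, d.hasForm hβ hd⟩
  have span_le : ∀ s : Set (Ostrovsky.SmoothField I), s ⊆ Ostrovsky.pointSymmetries I α β h →
      (Submodule.span ℝ s : Set (Ostrovsky.SmoothField I))
        ⊆ Ostrovsky.pointSymmetries I α β h := fun s hs => by
    rw [← hS] at hs ⊢
    exact Submodule.span_le.2 hs
  have both : ∀ (d : Ostrovsky.BoostData I) (d' : Ostrovsky.FrameData I),
      d.IsForcing β h → d'.IsForcing h → Ostrovsky.pointSymmetries I α β h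
        = (Submodule.span ℝ {d.generator β, d'.generator β} :
            Set (Ostrovsky.SmoothField I)) := by
    intro d d' hd hd'
    refine Set.Subset.antisymm (fun V hV => ?_) (span_le _ ?_)
    · obtain ⟨T, c, g, hV⟩ := (mem V).1 hV
      -- Subtraction of `T X₁` leaves a symmetry without `∂_t` component.
      have h1 := hV.add_smul (d.hasForm hβ hd) (-T)
      rw [mul_one, add_neg_cancel] at h1
      obtain ⟨r, hr⟩ := h1.exists_eq_smul_frame hβ hI hh hd'
      refine Submodule.mem_span_pair.2 ⟨T, r, ?_⟩
      rw [← hr, neg_smul]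
      abel
    · rintro V (rfl | rfl)
      exacts [boost d hd, frame d' hd']
  refine ⟨⟨boost, frame, ?_, ?_, ?_, both⟩, ⟨?_, ?_⟩, ?_⟩
  · intro hB hF
    refine Set.Subset.antisymm (fun V hV => ?_) ?_
    · obtain ⟨T, c, g, hV⟩ := (mem V).1 hV
      obtain rfl := hV.time_eq_zero hI hh hB
      by_contra hne
      exact hF (hV.exists_frameData hβ hI hh hne)
    · rintro V rfl
      rw [← hS]
      exact S.zero_mem
  · intro d hd hF
    refine Set.Subset.antisymm (fun V hV => ?_)
      (span_le _ (Set.singleton_subset_iff.2 (boost d hd)))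
    obtain ⟨T, c, g, hV⟩ := (mem V).1 hV
    exact Submodule.mem_span_singleton.2 ⟨T, (hV.eq_smul_boost hβ hI hh hd hF).symm⟩
  · intro d hd hB
    refine Set.Subset.antisymm (fun V hV => ?_)
      (span_le _ (Set.singleton_subset_iff.2 (frame d hd)))
    obtain ⟨T, c, g, hV⟩ := (mem V).1 hV
    obtain rfl := hV.time_eq_zero hI hh hB
    obtain ⟨r, hr⟩ := hV.exists_eq_smul_frame hβ hI hh hd
    exact Submodule.mem_span_singleton.2 ⟨r, hr.symm⟩
  · rintro ⟨⟨d, hd⟩, d', hd'⟩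
    refine ⟨(d.h₁ 1 + d.h₁ (-1) - 2 * d.h₁ 0) / 2, d'.h₁, d'.h₀, d'.contDiffOn_h₁,
      d'.contDiffOn_h₀, fun x t ht => ?_⟩
    rw [hd' x t ht, Ostrovsky.FrameData.h₂_eq_of_boostData hd hd' ht]
  · rintro ⟨k, l₁, l₀, h₁, h₀, hq⟩
    obtain ⟨d, hd, -⟩ := Ostrovsky.exists_boostData_of_quadratic hβ hI h₁ h₀ hq
    exact ⟨⟨d, hd⟩, Ostrovsky.exists_frameData_of_quadratic h₁ h₀ hq⟩
  · intro k l₁ l₀ h₁ h₀ hq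
    obtain ⟨d, hd, hdk⟩ := Ostrovsky.exists_boostData_of_quadratic hβ hI h₁ h₀ hq
    obtain ⟨d', hd'⟩ := Ostrovsky.exists_frameData_of_quadratic h₁ h₀ hq
    refine ⟨?_, fun d d' hd hd' => Ostrovsky.lie_generators hβ hq hd hd',
      Ostrovsky.FrameData.isForcing_iff hq, ⟨d, hd, hdk⟩,
      Ostrovsky.BoostData.isForcing_iff hβ hq⟩
    rw [both d d' hd hd']
    exact Ostrovsky.exists_solvable_lieSubalgebra (Ostrovsky.lie_generators hβ hq hd hd')
      (Ostrovsky.linearIndependent_generators hI β d d')
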